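/- Let $G$ be a (finite) plane-bipartite graph: a finite graph, possibly with multiple edges and not necessarily connected, drawn in a closed disk (with polygonal arcs as edges, meeting only at common end vertices), with $n\ge 0$ boundary vertices on the boundary circle, labelled in clockwise order, and with internal vertices strictly inside the disk, coloured black and white, such that every edge joins two internal vertices of different colours or an internal vertex and a boundary vertex, and every boundary vertex is incident to exactly one edge. In an edge with a boundary vertex as one end, that end counts as having the colour opposite to the internal end. An almost perfect matching of $G$ is a set $M$ of edges such that every internal vertex is incident to exactly one edge in $M$. The matching polytope $P(G)\subset\mathbb{R}^{E(G)}$ is the convex hull of the $0$-$1$ indicator vectors of the almost perfect matchings of $G$. A subgraph $H$ of $G$ that contains all vertices is called elementary if every edge of $H$ lies in an almost perfect matching of $G$ that is contained in $H$. The faces of $G$ are the connected components of the disk minus the drawing of $G$. Two edges $e,e'$ are equivalent if there are two distinct faces $f\neq f'$ of $G$ such that, when $e$ and $e'$ are travelled from their black to their white ends, $f$ lies on the left and $f'$ lies on the right of both $e$ and $e'$. (This is an equivalence relation on the set of those edges that have different faces on their two sides; an edge with the same face on both sides belongs to no equivalence class.) A facet of a polytope $P$ is a non-empty face of dimension $\dim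 P-1$. Theorem. Suppose that $G$ is elementary. Then $$H\longmapsto \phi(H)=\{x\in P(G) : x_e=0 \text{ for every edge } e \notin H\}$$ is a bijection from the set of elementary subgraphs of the form $H=G\setminus E$, where $E$ is an equivalence class of edges, onto the set of facets of $P(G)$. Its inverse sends a facet $F$ to the subgraph whose edges are those $e$ for which $x_e$ is not identically zero on $F$. Moreover, if $e$ is an edge with different faces on its two sides and $e'$ is any edge, then $e$ and $e'$ are equivalent if and only if the coordinate functionals $x_e$ and $x_{e'}$ agree on $P(G)$. -/

import Mathlib

open Set Filter Topology

/-- The two colours of internal vertices. -/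
inductive VertexColor : Type
  | black
  | white

/-- A plane-bipartite graph drawn in the closed unit disk of `ℂ`, with `n` boundary vertices,
internal vertices `V` and edges `E` (multiple edges are allowed).
Every edge is drawn as a simple polygonal arc, and is parametrised from its black end to its
white end. Boundary vertices carry no colour of their own: the boundary end of an edge counts as
the end whose colour is opposite to that of the internal end. -/
structure PlaneBipartiteGraph (n : ℕ) (V : Type*) (E : Type*) where
  /-- the colour of an internal vertex -/
  color : V → VertexColor
  /-- the end of an edge that is (or counts as) black -/
  blackEnd : E → V ⊕ Fin n
  /-- the end of an edge that is (or counts as) white -/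
  whiteEnd : E → V ⊕ Fin n
  color_blackEnd : ∀ e v, blackEnd e = Sum.inl v → color v = VertexColor.black
  color_whiteEnd : ∀ e v, whiteEnd e = Sum.inl v → color v = VertexColor.white
  /-- no edge joins two boundary vertices -/
  exists_internal_end : ∀ e, ∃ v, blackEnd e = Sum.inl v ∨ whiteEnd e = Sum.inl v
  /-- every boundary vertex is incident to a single edge -/
  boundary_edge : ∀ i, ∃! e, blackEnd e = Sum.inr i ∨ whiteEnd e = Sum.inr i
  /-- the point of the disk at which a vertex is drawn -/
  place : V ⊕ Fin n → ℂ
  place_injective : Function.Injective place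
  /-- internal vertices are strictly inside the disk -/
  place_internal : ∀ v, ‖place (Sum.inl v)‖ < 1
  /-- the angles of the boundary vertices -/
  angle : Fin n → ℝ
  /-- boundary vertices are on the boundary circle ... -/
  place_boundary : ∀ i, place (Sum.inr i) = Complex.exp (angle i * Complex.I)
  /-- ... labelled in clockwise order ... -/
  angle_strictAnti : StrictAnti angle
  /-- ... within one turn -/
  angle_lt : ∀ i j, angle i < angle j + 2 * Real.pi
  /-- the number of segments of the polygonal arc of an edge -/
  len : E → ℕ
  len_pos : ∀ e, 0 < len e
  /-- the corners `pt e 0, …, pt e (len e)` of the polygonal arc of an edge -/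
  pt : E → ℕ → ℂ
  pt_zero : ∀ e, pt e 0 = place (blackEnd e)
  pt_len : ∀ e, pt e (len e) = place (whiteEnd e)
  pt_inside : ∀ e i, 0 < i → i < len e → ‖pt e i‖ < 1
  pt_ne : ∀ e i, i < len e → pt e i ≠ pt e (i + 1)
  /-- the arc of an edge does not meet itself -/
  arc_simple : ∀ e i j z, i < j → j < len e →
    z ∈ segment ℝ (pt e i) (pt e (i + 1)) → z ∈ segment ℝ (pt e j) (pt e (j + 1)) →
    j = i + 1 ∧ z = pt e j
  /-- the arc of an edge passes through no vertex other than its two ends -/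
  arc_avoids : ∀ e i w, i < len e → place w ∈ segment ℝ (pt e i) (pt e (i + 1)) →
    w = blackEnd e ∨ w = whiteEnd e
  /-- the arcs of two different edges meet only at vertices -/
  arcs_disjoint : ∀ e e' i i' z, e ≠ e' → i < len e → i' < len e' →
    z ∈ segment ℝ (pt e i) (pt e (i + 1)) → z ∈ segment ℝ (pt e' i') (pt e' (i' + 1)) →
    ∃ w, z = place w

namespace PlaneBipartiteGraph

variable {n : ℕ} {V E : Type*}

/-- The vertex `w` is an end of the edge `e`. -/
def Incident (G : PlaneBipartiteGraph n V E) (e : E) (w : V ⊕ Fin n) : Prop :=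
  G.blackEnd e = w ∨ G.whiteEnd e = w

/-- The union of all vertices and edges, as drawn in the disk. -/
def drawing (G : PlaneBipartiteGraph n V E) : Set ℂ :=
  range G.place ∪ ⋃ e, ⋃ i, ⋃ (_ : i < G.len e), segment ℝ (G.pt e i) (G.pt e (i + 1))

/-- The interior of the disk with the drawing of `G` removed. -/
def region (G : PlaneBipartiteGraph n V E) : Set ℂ :=
  Metric.ball (0 : ℂ) 1 \ G.drawing

/-- The faces of `G` are the connected components of the disk with the drawing removed. -/
def IsFace (G : PlaneBipartiteGraph n V E) (f : Set ℂ) : Prop :=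
  ∃ z ∈ G.region, f = connectedComponentIn G.region z

/-- The face `f` lies on the left of the edge `e`, when `e` is travelled from black to white:
from every point `z` in the interior of a segment of `e`, one enters `f` when one moves off
a little in the direction obtained by turning the direction of travel by `π / 2`. -/
def IsLeftFace (G : PlaneBipartiteGraph n V E) (e : E) (f : Set ℂ) : Prop :=
  G.IsFace f ∧ ∀ i < G.len e, ∀ z ∈ openSegment ℝ (G.pt e i) (G.pt e (i + 1)),
    ∀ᶠ t : ℝ in 𝓝[>] 0, z + t * (Complex.I * (G.pt e (i + 1) - G.pt e i)) ∈ f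

/-- The face `f` lies on the right of the edge `e`, when `e` is travelled from black to white. -/
def IsRightFace (G : PlaneBipartiteGraph n V E) (e : E) (f : Set ℂ) : Prop :=
  G.IsFace f ∧ ∀ i < G.len e, ∀ z ∈ openSegment ℝ (G.pt e i) (G.pt e (i + 1)),
    ∀ᶠ t : ℝ in 𝓝[>] 0, z - t * (Complex.I * (G.pt e (i + 1) - G.pt e i)) ∈ f

/-- The edge `e` separates two distinct faces, `f` on its left and `f'` on its right. -/
def Separates (G : PlaneBipartiteGraph n V E) (e : E) (f f' : Set ℂ) : Prop :=
  f ≠ f' ∧ G.IsLeftFace e f ∧ G.IsRightFace e f'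

/-- Two edges are equivalent if they separate the same pair of distinct faces with the same
orientation. An edge with the same face on both sides is not equivalent to any edge. -/
def Equivalent (G : PlaneBipartiteGraph n V E) (e e' : E) : Prop :=
  ∃ f f', G.Separates e f f' ∧ G.Separates e' f f'

/-- `C` is an equivalence class of edges. -/
def IsEdgeClass (G : PlaneBipartiteGraph n V E) (C : Set E) : Prop :=
  ∃ e ∈ C, C = {e' | G.Equivalent e e'}

/-- An almost perfect matching: a set of edges such that each internal vertex is incident to
exactly one of them. (A boundary vertex has only one edge, so it needs no condition.) -/
def IsAlmostPerfectMatching (G : PlaneBipartiteGraph n V E) (M : Set E) : Prop :=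
  ∀ v : V, ∃! e, e ∈ M ∧ G.Incident e (Sum.inl v)

/-- The subgraph with all vertices of `G` and with edge set `H` is elementary: each of its edges
is used in an almost perfect matching of the subgraph. -/
def IsElementary (G : PlaneBipartiteGraph n V E) (H : Set E) : Prop :=
  ∀ e ∈ H, ∃ M ⊆ H, G.IsAlmostPerfectMatching M ∧ e ∈ M

/-- The matching polytope `P(G)` in `ℝ^E`: the convex hull of the 0-1 vectors of the almost perfect
matchings of `G`. -/
noncomputable def matchingPolytope (G : PlaneBipartiteGraph n V E) : Set (E → ℝ) :=
  convexHull ℝ {x | ∃ M, G.IsAlmostPerfectMatching M ∧ x = M.indicator 1}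

/-- The points of `P(G)` that vanish on all edges outside the subgraph with edge set `H`. -/
def faceOfSubgraph (G : PlaneBipartiteGraph n V E) (H : Set E) : Set (E → ℝ) :=
  {x ∈ G.matchingPolytope | ∀ e ∉ H, x e = 0}

end PlaneBipartiteGraph

/-- The edge set of the subgraph attached to a subset `F` of `ℝ^E`: the edges whose coordinate
functional is not identically zero on `F`. -/
def supportingEdges {E : Type*} (F : Set (E → ℝ)) : Set E :=
  {e | ∃ x ∈ F, x e ≠ 0}

/-- `F` is a facet of the polytope `P`: a non-empty face (the locus where a linear functional
attains its maximum over `P`) of dimension `dim P - 1`. -/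
def IsPolytopeFacet {E : Type*} (P F : Set (E → ℝ)) : Prop :=
  F.Nonempty ∧ IsExposed ℝ P F ∧
    Module.finrank ℝ (vectorSpan ℝ F) + 1 = Module.finrank ℝ (vectorSpan ℝ P)

/-!
The matching polytope `P(G)` consists of the nonnegative edge vectors whose sums at the internal
vertices are all `1` (`matchingPolytope_eq`): an extreme point with fractional coordinates could
be moved along a balanced vector, that is one with vanishing vertex sums, and such a vector exists
because on the fractional edges there are at most as many vertices as edges and, in case of
equality, the signed sum of the vertex equations vanishes. For elementary `G` the directions of
`P(G)` are therefore all balanced vectors, and a nonempty exposed face is cut out by the vanishing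
of the coordinates outside its supporting edges (`faceOfSubgraph_supportingEdges`). A facet is the
zero locus of a single coordinate, and the other coordinates vanishing on it are proportional,
hence equal, to this one, since matchings have coordinates `0` and `1`. It remains to see that,
for an edge with different faces on its two sides, equality of coordinates on `P(G)` is
equivalence of edges (`equivalent_iff`), and that the coordinate of any other edge is constant
(`equivalent_self_iff`). Both rest on planarity, through two constructions.

*Boundary vectors.* For a face `f`, the vector that is `1` on edges with `f` on the left and `-1`
on edges with `f` on the right is balanced (`boundaryVector_mem`), because around an internal
vertex the left side of each edge is the right side of the next one. This follows by dividing a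
small disk into sectors (`exists_perm_sides`), which also shows that each side of a polygonal arc
is in a single face. So edges with equal coordinates have the same faces on the left and on the
right.

*Closed curves.* If `e` and `e'` are equivalent, a closed curve in the open disk crosses `e` from
right to left and `e'` from left to right, and meets nothing else. Its winding angle around the
vertices is a potential that vanishes on the boundary circle and changes only along `e` and `e'`
(`exists_potential_of_equivalent`); summation by parts shows that `x e - x e'` is constant on
`P(G)`, and the constant is `0` because both edges lie in matchings. An edge with the same face on
both sides is crossed by a closed curve that meets no other edge, so that its coordinate is
constant. Curves are not used as such: `IsTurning` records the angle through which the direction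
from a point to a moving point turns, which is additive under concatenation.
-/

/-! ### Sectors around a point and the sides of rays -/

/-- Starting at `z`, one enters the set `f` when one moves off a little in the direction `w`. -/
def EntersAlong (f : Set ℂ) (z w : ℂ) : Prop :=
  ∀ᶠ t : ℝ in 𝓝[>] 0, z + t * w ∈ f

/-- The open circular sector with apex `p` swept counterclockwise from the direction `u` through
the angle `α`; the radius `ε` is measured in units of `‖u‖`. -/
def sector (p u : ℂ) (α ε : ℝ) : Set ℂ :=
  (fun x : ℝ × ℝ => p + x.1 * u * Complex.exp (x.2 * Complex.I)) '' (Ioo 0 ε ×ˢ Ioo 0 α)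

/-- The set `f` absorbs every preconnected subset of `R` that it meets. -/
def AbsorbsIn (R f : Set ℂ) : Prop :=
  ∀ S ⊆ R, IsPreconnected S → (S ∩ f).Nonempty → S ⊆ f

lemma isPreconnected_sector (p u : ℂ) (α ε : ℝ) : IsPreconnected (sector p u α ε) := by
  apply IsPreconnected.image (isPreconnected_Ioo.prod isPreconnected_Ioo)
  fun_prop

lemma AbsorbsIn.entersAlong_iff {R f S : Set ℂ} (hf : AbsorbsIn R f) (hS : S ⊆ R)
    (hc : IsPreconnected S) {z w : ℂ} (h : EntersAlong S z w) :
    EntersAlong f z w ↔ S ⊆ f := by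
  constructor
  · intro hq
    obtain ⟨t, h1, h2⟩ := (h.and hq).exists
    exact hf S hS hc ⟨_, h1, h2⟩
  · intro hs
    exact h.mono fun t ht => hs ht

lemma entersAlong_sector_start {p u : ℂ} {α ε s : ℝ} (hα : 0 < α) (hs : 0 < s) (hse : s < ε) :
    EntersAlong (sector p u α ε) (p + s * u) (Complex.I * u) := by
  have hc : ContinuousAt (fun t : ℝ => (s : ℂ) + t * Complex.I) 0 := by fun_prop
  have h1 : ∀ᶠ t : ℝ in 𝓝 0, ‖(s : ℂ) + t * Complex.I‖ < ε := by
    apply hc.norm.eventually_lt_const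
    simpa [abs_of_pos hs] using hse
  have h2 : ∀ᶠ t : ℝ in 𝓝 0, Complex.arg ((s : ℂ) + t * Complex.I) < α := by
    have : ContinuousAt (fun t : ℝ => Complex.arg ((s : ℂ) + t * Complex.I)) 0 := by
      apply ContinuousAt.comp' (f := fun t : ℝ => (s : ℂ) + t * Complex.I) _ hc
      apply Complex.continuousAt_arg
      simp [Complex.mem_slitPlane_iff, hs]
    apply this.eventually_lt_const
    simpa [Complex.arg_ofReal_of_nonneg hs.le] using hα
  filter_upwards [nhdsWithin_le_nhds h1, nhdsWithin_le_nhds h2, self_mem_nhdsWithin]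
    with t h1 h2 h3
  have h3 : 0 < t := h3
  refine ⟨(‖(s : ℂ) + t * Complex.I‖, Complex.arg ((s : ℂ) + t * Complex.I)),
    ⟨⟨?_, h1⟩, ⟨?_, h2⟩⟩, ?_⟩
  · rw [norm_pos_iff]
    intro h
    have := congrArg Complex.re h
    simp at this
    exact hs.ne' this
  · refine lt_of_le_of_ne (Complex.arg_nonneg_iff.2 (by simp [h3.le])) fun h => ?_
    have := (Complex.arg_eq_zero_iff.1 h.symm).2
    simp at this
    exact h3.ne' this
  · have := Complex.norm_mul_exp_arg_mul_I ((s : ℂ) + t * Complex.I)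
    simp only
    rw [mul_right_comm, this]
    ring

lemma entersAlong_sector_end {p u : ℂ} {α ε s c : ℝ} (hα : 0 < α) (hc : 0 < c) (hs : 0 < s)
    (hse : s * c < ε) :
    EntersAlong (sector p u α ε) (p + s * (c * Complex.exp (α * Complex.I) * u))
      (-(Complex.I * (c * Complex.exp (α * Complex.I) * u))) := by
  have hc' : ContinuousAt (fun t : ℝ => (s : ℂ) - t * Complex.I) 0 := by fun_prop
  have h1 : ∀ᶠ t : ℝ in 𝓝 0, ‖(s : ℂ) - t * Complex.I‖ * c < ε := by
    apply (hc'.norm.mul_const c).eventually_lt_const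
    simpa [abs_of_pos hs] using hse
  have h2 : ∀ᶠ t : ℝ in 𝓝 0, -α < Complex.arg ((s : ℂ) - t * Complex.I) := by
    have : ContinuousAt (fun t : ℝ => Complex.arg ((s : ℂ) - t * Complex.I)) 0 := by
      apply ContinuousAt.comp' (f := fun t : ℝ => (s : ℂ) - t * Complex.I) _ hc'
      apply Complex.continuousAt_arg
      simp [Complex.mem_slitPlane_iff, hs]
    apply this.eventually_const_lt
    simpa [Complex.arg_ofReal_of_nonneg hs.le] using hα
  filter_upwards [nhdsWithin_le_nhds h1, nhdsWithin_le_nhds h2, self_mem_nhdsWithin]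
    with t h1 h2 h3
  have h3 : 0 < t := h3
  refine ⟨(‖(s : ℂ) - t * Complex.I‖ * c, α + Complex.arg ((s : ℂ) - t * Complex.I)),
    ⟨⟨mul_pos ?_ hc, h1⟩, ⟨by simp only; linarith, ?_⟩⟩, ?_⟩
  · rw [norm_pos_iff]
    intro h
    have := congrArg Complex.re h
    simp at this
    exact hs.ne' this
  · have : Complex.arg ((s : ℂ) - t * Complex.I) < 0 := Complex.arg_neg_iff.2 (by simp [h3])
    simp only
    linarith
  · have := Complex.norm_mul_exp_arg_mul_I ((s : ℂ) - t * Complex.I)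
    simp only
    push_cast
    rw [add_mul, Complex.exp_add]
    linear_combination (c * u * Complex.exp (α * Complex.I)) * this

lemma entersAlong_sector_pi_apex {p u : ℂ} {ε : ℝ} (hε : 0 < ε) :
    EntersAlong (sector p u Real.pi ε) p (Complex.I * u) := by
  filter_upwards [Ioo_mem_nhdsGT hε] with t ht
  refine ⟨(t, Real.pi / 2), ⟨ht, ⟨by positivity, by linarith [Real.pi_pos]⟩⟩, ?_⟩
  simp only
  push_cast
  rw [Complex.exp_pi_div_two_mul_I]
  ring

/-- If every point of an open segment has a half disk to the left of the segment in `R`, then the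
left side of the segment is in the same component of `R` all along. -/
lemma AbsorbsIn.entersAlong_segment {R f : Set ℂ} (hf : AbsorbsIn R f) {a b : ℂ}
    (h : ∀ z ∈ openSegment ℝ a b, ∃ ε > 0, sector z (b - a) Real.pi ε ⊆ R) {z z' : ℂ}
    (hz : z ∈ openSegment ℝ a b) (hz' : z' ∈ openSegment ℝ a b) :
    EntersAlong f z (Complex.I * (b - a)) ↔ EntersAlong f z' (Complex.I * (b - a)) := by
  have key : ∀ s ∈ Ioo (0 : ℝ) 1, ∀ᶠ s' : ℝ in 𝓝 s,
      (EntersAlong f (a + s * (b - a)) (Complex.I * (b - a)) ↔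
        EntersAlong f (a + s' * (b - a)) (Complex.I * (b - a))) := by
    intro s hs
    have hmem : a + s * (b - a) ∈ openSegment ℝ a b := by
      rw [openSegment_eq_image']
      exact ⟨s, hs, by simp⟩
    obtain ⟨ε, hε, hR⟩ := h _ hmem
    have h0 := hf.entersAlong_iff hR (isPreconnected_sector _ _ _ _)
      (entersAlong_sector_pi_apex hε)
    filter_upwards [Ioo_mem_nhds (show s - ε < s by linarith) (show s < s + ε by linarith)]
      with s' hs'
    rcases lt_trichotomy s' s with hlt | rfl | hgt
    · have h1 := hf.entersAlong_iff hR (isPreconnected_sector _ _ _ _)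
        (entersAlong_sector_end (c := 1) (s := s - s') Real.pi_pos one_pos (by linarith)
          (by linarith [hs'.1]))
      rw [h0, ← h1]
      rw [iff_eq_eq]
      congr 1
      · rw [Complex.exp_pi_mul_I]; push_cast; ring
      · rw [Complex.exp_pi_mul_I]; push_cast; ring
    · rfl
    · have h1 := hf.entersAlong_iff hR (isPreconnected_sector _ _ _ _)
        (entersAlong_sector_start (s := s' - s) Real.pi_pos (by linarith) (by linarith [hs'.2]))
      rw [h0, ← h1, iff_eq_eq]
      congr 1
      push_cast; ring
  rw [openSegment_eq_image'] at hz hz'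
  obtain ⟨s, hs, rfl⟩ := hz
  obtain ⟨s', hs', rfl⟩ := hz'
  simp only [Complex.real_smul]
  refine (isPreconnected_Ioo (a := (0 : ℝ)) (b := 1)).induction₂
    (fun s s' : ℝ => (EntersAlong f (a + s * (b - a)) (Complex.I * (b - a)) ↔
        EntersAlong f (a + s' * (b - a)) (Complex.I * (b - a)))) ?_ ?_ ?_ hs hs'
  · intro x hx
    exact nhdsWithin_le_nhds (key x hx)
  · intro x y z _ _ _ h1 h2
    exact h1.trans h2
  · intro x y _ _ h1
    exact h1.symm

lemma exists_rotation {u v : ℂ} (hu : u ≠ 0) (hv : v ≠ 0) :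
    ∃ φ : ℝ, 0 < φ ∧ φ ≤ 2 * Real.pi ∧
      ∃ c : ℝ, 0 < c ∧ v = c * Complex.exp (φ * Complex.I) * u := by
  have h := Complex.norm_mul_exp_arg_mul_I (v / u)
  have h0 : 0 < ‖v / u‖ := norm_pos_iff.2 (div_ne_zero hv hu)
  by_cases ha : 0 < Complex.arg (v / u)
  · refine ⟨_, ha, by linarith [Complex.arg_le_pi (v / u), Real.pi_pos], _, h0, ?_⟩
    rw [h, div_mul_cancel₀ _ hu]
  · refine ⟨Complex.arg (v / u) + 2 * Real.pi,
      by linarith [Complex.neg_pi_lt_arg (v / u), Real.pi_pos],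
      by linarith, _, h0, ?_⟩
    push_cast
    rw [add_mul, Complex.exp_add, Complex.exp_two_pi_mul_I, mul_one, h, div_mul_cancel₀ _ hu]

lemma rotation_unique {u : ℂ} (hu : u ≠ 0) {φ φ' c c' : ℝ} (h0 : 0 < φ) (h1 : φ ≤ 2 * Real.pi)
    (h0' : 0 < φ') (h1' : φ' ≤ 2 * Real.pi) (hc : 0 < c) (hc' : 0 < c')
    (h : c * Complex.exp (φ * Complex.I) * u = c' * Complex.exp (φ' * Complex.I) * u) :
    φ = φ' := by
  have h2 := mul_right_cancel₀ hu h
  have h3 : c = c' := by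
    have := congrArg norm h2
    simpa [Complex.norm_exp_ofReal_mul_I, abs_of_pos hc, abs_of_pos hc'] using this
  subst h3
  have h4 := mul_left_cancel₀ (Complex.ofReal_ne_zero.2 hc.ne') h2
  rw [Complex.exp_eq_exp_iff_exists_int] at h4
  obtain ⟨k, hk⟩ := h4
  have h5 : φ = φ' + k * (2 * Real.pi) := by
    have : ((φ : ℝ) : ℂ) = ((φ' + k * (2 * Real.pi) : ℝ) : ℂ) := by
      apply mul_right_cancel₀ Complex.I_ne_zero
      rw [hk]; push_cast; ring
    exact_mod_cast this
  have hk1 : (k : ℝ) < 1 := by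
    by_contra hcon
    push Not at hcon
    nlinarith [Real.pi_pos]
  have hk2 : (-1 : ℝ) < k := by
    by_contra hcon
    push Not at hcon
    nlinarith [Real.pi_pos]
  have hk1' : k < 1 := by exact_mod_cast hk1
  have hk2' : -1 < k := by exact_mod_cast hk2
  have : k = 0 := by omega
  subst this
  simpa using h5

/-- The rays `p + s • u i` in finitely many directions cut a punctured neighbourhood of `p` into
sectors. The permutation `σ` sends a ray to the next one counterclockwise, so that the left side of
ray `i` and the right side of ray `σ i` are in the same sector. -/
lemma exists_perm_sides {ι : Type*} [Finite ι] {R : Set ℂ} {p : ℂ} {u : ι → ℂ}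
    (hu : ∀ i, u i ≠ 0)
    (hdist : ∀ i j, ∀ c : ℝ, 0 < c → u j = c * u i → i = j)
    (hR : ∀ᶠ q in 𝓝 p, q ≠ p → (∀ i, ∀ s : ℝ, 0 < s → q ≠ p + s * u i) → q ∈ R) :
    ∃ σ : Equiv.Perm ι, (∀ i j, i ≠ j → σ i ≠ i) ∧
      ∀ f, AbsorbsIn R f → ∀ i, ∀ᶠ s : ℝ in 𝓝[>] 0,
        (EntersAlong f (p + s * u i) (Complex.I * u i) ↔
          EntersAlong f (p + s * u (σ i)) (-(Complex.I * u (σ i)))) := by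
  -- `gap i j` in `(0, 2π]` is the angle from ray `i` counterclockwise to ray `j`
  choose gap hgap0 hgap1 c hc hrot using fun i j => exists_rotation (hu i) (hu j)
  have huniq : ∀ i j (φ d : ℝ), 0 < φ → φ ≤ 2 * Real.pi → 0 < d →
      u j = d * Complex.exp (φ * Complex.I) * u i → φ = gap i j := by
    intro i j φ d h0 h1 hd h
    exact rotation_unique (hu i) h0 h1 (hgap0 i j) (hgap1 i j) hd (hc i j) (h.symm.trans (hrot i j))
  have hmin : ∀ i, ∃ j, ∀ k, gap i j ≤ gap i k := by
    intro i
    have : Nonempty ι := ⟨i⟩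
    exact Finite.exists_min (gap i)
  choose next hnext using hmin
  have hgapii : ∀ i, gap i i = 2 * Real.pi := by
    intro i
    refine (huniq i i (2 * Real.pi) 1 (by positivity) le_rfl one_pos ?_).symm
    push_cast
    rw [Complex.exp_two_pi_mul_I]
    ring
  -- if rays `i ≠ j` had the same successor `k`, one of them would lie between the other and `k`
  have hlt : ∀ i j, next i = next j → ¬ gap i (next i) < gap j (next j) := by
    intro i j hij hl
    have h1 := hrot i (next i)
    have h2 := hrot j (next j)
    rw [← hij] at h2 hl
    have hci := hc i (next i)
    have hcj := hc j (next i)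
    have h3 : gap j (next i) - gap i (next i) = gap j i := by
      refine huniq j i _ (c j (next i) / c i (next i)) (by linarith)
        (by linarith [hgap0 i (next i), hgap1 j (next i)]) (by positivity) ?_
      have hne : (c i (next i) : ℂ) ≠ 0 := Complex.ofReal_ne_zero.2 hci.ne'
      push_cast
      rw [sub_mul, Complex.exp_sub]
      have hee := Complex.exp_ne_zero (gap i (next i) * Complex.I)
      rw [h1] at h2
      generalize Complex.exp (gap i (next i) * Complex.I) = z at *
      field_simp
      linear_combination h2
    have h4 := hnext j i
    rw [← hij] at h4
    linarith [hgap0 i (next i)]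
  have hinj : Function.Injective next := by
    intro i j hij
    have heq : gap i (next i) = gap j (next j) :=
      le_antisymm (not_lt.1 (hlt j i hij.symm)) (not_lt.1 (hlt i j hij))
    have h1 := hrot i (next i)
    have h2 := hrot j (next j)
    rw [← heq, ← hij] at h2
    have hci := hc i (next i)
    have hcj := hc j (next i)
    refine hdist i j (c i (next i) / c j (next i)) (by positivity) ?_
    have hne : (c j (next i) : ℂ) ≠ 0 := Complex.ofReal_ne_zero.2 hcj.ne'
    have hee := Complex.exp_ne_zero (gap i (next i) * Complex.I)
    push_cast
    field_simp
    rw [h1] at h2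
    apply mul_right_cancel₀ hee
    linear_combination -h2
  refine ⟨Equiv.ofBijective next (Finite.injective_iff_bijective.1 hinj), ?_, ?_⟩
  · intro i j hij h
    simp only [Equiv.ofBijective_apply] at h
    have h1 : gap i j = 2 * Real.pi := by
      refine le_antisymm (hgap1 i j) ?_
      have := hnext i j
      rwa [h, hgapii] at this
    have h2 := hrot i j
    rw [h1] at h2
    push_cast at h2
    rw [Complex.exp_two_pi_mul_I, mul_one] at h2
    exact hij (hdist i j _ (hc i j) h2)
  · intro f hf i
    simp only [Equiv.ofBijective_apply]
    obtain ⟨δ, hδ, hball⟩ := Metric.eventually_nhds_iff.1 hR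
    have hui : 0 < ‖u i‖ := norm_pos_iff.2 (hu i)
    have hsub : sector p (u i) (gap i (next i)) (δ / ‖u i‖) ⊆ R := by
      rintro _ ⟨⟨r, φ⟩, ⟨⟨hr0, hr1⟩, ⟨hφ0, hφ1⟩⟩, rfl⟩
      simp only at hr0 hr1 hφ0 hφ1 ⊢
      apply hball
      · simp only [dist_self_add_left, norm_mul, Complex.norm_exp_ofReal_mul_I, mul_one,
          Complex.norm_real, Real.norm_eq_abs, abs_of_pos hr0]
        exact (lt_div_iff₀ hui).1 hr1
      · simp [hr0.ne', hu i]
      · intro j s hs hq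
        have h2 := add_left_cancel hq
        have h3 : φ = gap i j := by
          refine huniq i j φ (r / s) hφ0 (by linarith [hgap1 i (next i)]) (by positivity) ?_
          have hne : (s : ℂ) ≠ 0 := Complex.ofReal_ne_zero.2 hs.ne'
          push_cast
          field_simp
          linear_combination -h2
        linarith [hnext i j]
    have hd : 0 < δ / ‖u i‖ := by positivity
    have hci := hc i (next i)
    filter_upwards [Ioo_mem_nhdsGT hd, Ioo_mem_nhdsGT (div_pos hd hci)] with s hs1 hs2
    rw [hf.entersAlong_iff hsub (isPreconnected_sector _ _ _ _)
      (entersAlong_sector_start (hgap0 _ _) hs1.1 hs1.2)]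
    have h2 := hrot i (next i)
    have h3 := hf.entersAlong_iff hsub (isPreconnected_sector _ _ _ _)
      (entersAlong_sector_end (hgap0 _ _) hci hs2.1 ((lt_div_iff₀ hci).1 hs2.2))
    rw [← h2] at h3
    exact h3.symm

/-! ### The drawing near a point -/

lemma isClosed_segment (a b : ℂ) : IsClosed (segment ℝ a b) := by
  rw [segment_eq_image]
  exact (isCompact_Icc.image (by fun_prop)).isClosed

lemma exists_sector_pi_subset {R : Set ℂ} {z d : ℂ} (hd : d ≠ 0)
    (h : ∀ᶠ q in 𝓝 z, (∀ t : ℝ, q ≠ z + t * d) → q ∈ R) :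
    ∃ ε > 0, sector z d Real.pi ε ⊆ R := by
  obtain ⟨δ, hδ, hball⟩ := Metric.eventually_nhds_iff.1 h
  have hui : 0 < ‖d‖ := norm_pos_iff.2 hd
  refine ⟨δ / ‖d‖, by positivity, ?_⟩
  rintro _ ⟨⟨r, φ⟩, ⟨⟨hr0, hr1⟩, ⟨hφ0, hφ1⟩⟩, rfl⟩
  simp only at hr0 hr1 hφ0 hφ1 ⊢
  apply hball
  · simp only [dist_self_add_left, norm_mul, Complex.norm_exp_ofReal_mul_I, mul_one,
      Complex.norm_real, Real.norm_eq_abs, abs_of_pos hr0]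
    exact (lt_div_iff₀ hui).1 hr1
  · intro t ht
    have h1 := add_left_cancel ht
    have h2 : (r : ℂ) * Complex.exp (φ * Complex.I) = t := by
      apply mul_right_cancel₀ hd
      linear_combination h1
    have h3 := congrArg Complex.im h2
    rw [Complex.im_ofReal_mul, Complex.exp_ofReal_mul_I_im, Complex.ofReal_im] at h3
    exact (mul_pos hr0 (Real.sin_pos_of_pos_of_lt_pi hφ0 hφ1)).ne' h3

/-- Two distinct points `p`, `q` of a segment: `q` lies on the ray from `p` to one of the ends. -/
lemma mem_ray_of_mem_segment {a b p q : ℂ} (hp : p ∈ segment ℝ a b) (hq : q ∈ segment ℝ a b)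
    (hne : q ≠ p) :
    (a ≠ p ∧ ∃ s : ℝ, 0 < s ∧ q = p + s * (a - p)) ∨
      (b ≠ p ∧ ∃ s : ℝ, 0 < s ∧ q = p + s * (b - p)) := by
  rw [segment_eq_image'] at hp hq
  obtain ⟨x, hx, rfl⟩ := hp
  obtain ⟨y, hy, rfl⟩ := hq
  simp only [Complex.real_smul] at *
  have hba : b - a ≠ 0 := by
    intro h
    simp [h] at hne
  rcases lt_trichotomy x y with h | h | h
  · right
    have h1 : 0 < 1 - x := by linarith [hy.2]
    have h2 : (1 - x : ℂ) ≠ 0 := by exact_mod_cast h1.ne'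
    refine ⟨?_, (y - x) / (1 - x), div_pos (by linarith) h1, ?_⟩
    · intro hb
      apply mul_ne_zero h2 hba
      linear_combination hb
    · push_cast
      field_simp
      ring
  · exact absurd (by rw [h]) hne
  · left
    have h1 : 0 < x := by linarith [hy.1]
    have h2 : (x : ℂ) ≠ 0 := by exact_mod_cast h1.ne'
    refine ⟨?_, (x - y) / x, div_pos (by linarith) h1, ?_⟩
    · intro hb
      apply mul_ne_zero h2 hba
      linear_combination -hb
    · push_cast
      field_simp
      ring

lemma add_mul_mem_openSegment {a b : ℂ} {s : ℝ} (hs : s ∈ Ioo (0 : ℝ) 1) :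
    a + s * (b - a) ∈ openSegment ℝ a b := by
  rw [openSegment_eq_image']
  exact ⟨s, hs, by simp⟩

lemma add_mul_mem_openSegment' {a b : ℂ} {s : ℝ} (hs : s ∈ Ioo (0 : ℝ) 1) :
    b + s * (a - b) ∈ openSegment ℝ a b := by
  rw [openSegment_symm]
  exact add_mul_mem_openSegment hs

lemma openSegment_nonempty (a b : ℂ) : (openSegment ℝ a b).Nonempty :=
  ⟨_, add_mul_mem_openSegment (s := 1 / 2) (by norm_num)⟩

namespace PlaneBipartiteGraph

variable {n : ℕ} {V E : Type*} {G : PlaneBipartiteGraph n V E}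

lemma segment_subset_drawing {e : E} {i : ℕ} (hi : i < G.len e) :
    segment ℝ (G.pt e i) (G.pt e (i + 1)) ⊆ G.drawing := fun _ hz =>
  Or.inr (mem_iUnion.2 ⟨e, mem_iUnion.2 ⟨i, mem_iUnion.2 ⟨hi, hz⟩⟩⟩)

section finite
variable [Finite V] [Finite E]

lemma isClosed_drawing (G : PlaneBipartiteGraph n V E) : IsClosed G.drawing := by
  refine (finite_range _).isClosed.union (isClosed_iUnion_of_finite fun e => ?_)
  exact (finite_lt_nat (G.len e)).isClosed_biUnion fun i _ => isClosed_segment _ _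

lemma isOpen_region (G : PlaneBipartiteGraph n V E) : IsOpen G.region :=
  Metric.isOpen_ball.sdiff G.isClosed_drawing

lemma IsFace.isOpen {f : Set ℂ} (hf : G.IsFace f) : IsOpen f := by
  obtain ⟨z, -, rfl⟩ := hf
  exact G.isOpen_region.connectedComponentIn

/-- Near a point `p` the drawing consists of segments that contain `p`. -/
lemma eventually_mem_segment (G : PlaneBipartiteGraph n V E) (p : ℂ) :
    ∀ᶠ q in 𝓝 p, q ∈ G.drawing → q = p ∨ ∃ e i, i < G.len e ∧
      p ∈ segment ℝ (G.pt e i) (G.pt e (i + 1)) ∧ q ∈ segment ℝ (G.pt e i) (G.pt e (i + 1)) := by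
  have h1 : ∀ᶠ q in 𝓝 p, ∀ w, q = G.place w → q = p := by
    rw [eventually_all]
    intro w
    by_cases h : G.place w = p
    · exact Eventually.of_forall fun q hq => hq.trans h
    · filter_upwards [isOpen_ne.mem_nhds (Ne.symm h)] with q hq hq'
      exact absurd hq' hq
  have h2 : ∀ᶠ q in 𝓝 p, ∀ e, ∀ i ∈ {i | i < G.len e},
      q ∈ segment ℝ (G.pt e i) (G.pt e (i + 1)) → p ∈ segment ℝ (G.pt e i) (G.pt e (i + 1)) := by
    rw [eventually_all]
    intro e
    rw [eventually_all_finite (finite_lt_nat _)]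
    intro i _
    by_cases h : p ∈ segment ℝ (G.pt e i) (G.pt e (i + 1))
    · exact Eventually.of_forall fun _ _ => h
    · filter_upwards [(isClosed_segment _ _).isOpen_compl.mem_nhds h] with q hq hq'
      exact absurd hq' hq
  filter_upwards [h1, h2] with q h1 h2 hq
  rcases hq with ⟨w, rfl⟩ | hq
  · exact Or.inl (h1 w rfl)
  · simp only [mem_iUnion] at hq
    obtain ⟨e, i, hi, hq⟩ := hq
    exact Or.inr ⟨e, i, hi, h2 e i hi hq, hq⟩

/-- Near a point `p` inside the disk, a point belongs to the region unless it is `p` itself or lies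
on a ray from `p` along a segment of the drawing. -/
lemma eventually_mem_region {p : ℂ} (hp : ‖p‖ < 1) :
    ∀ᶠ q in 𝓝 p, q ≠ p → (∀ e i, i < G.len e → p ∈ segment ℝ (G.pt e i) (G.pt e (i + 1)) →
      ∀ s : ℝ, 0 < s → (G.pt e i ≠ p → q ≠ p + s * (G.pt e i - p)) ∧
        (G.pt e (i + 1) ≠ p → q ≠ p + s * (G.pt e (i + 1) - p))) → q ∈ G.region := by
  have hb : Metric.ball (0 : ℂ) 1 ∈ 𝓝 p := Metric.isOpen_ball.mem_nhds (by simpa using hp)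
  filter_upwards [G.eventually_mem_segment p, hb] with q h1 h2 hq h3
  refine ⟨h2, fun hd => ?_⟩
  rcases h1 hd with h | ⟨e, i, hi, hp', hq'⟩
  · exact hq h
  · rcases mem_ray_of_mem_segment hp' hq' hq with ⟨hne, s, hs, h⟩ | ⟨hne, s, hs, h⟩
    · exact (h3 e i hi hp' s hs).1 hne h
    · exact (h3 e i hi hp' s hs).2 hne h

end finite

lemma IsFace.subset_region {f : Set ℂ} (hf : G.IsFace f) : f ⊆ G.region := by
  obtain ⟨z, -, rfl⟩ := hf
  exact connectedComponentIn_subset _ _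

lemma IsFace.isPreconnected {f : Set ℂ} (hf : G.IsFace f) : IsPreconnected f := by
  obtain ⟨z, -, rfl⟩ := hf
  exact isPreconnected_connectedComponentIn

lemma IsFace.absorbsIn {f : Set ℂ} (hf : G.IsFace f) : AbsorbsIn G.region f := by
  obtain ⟨z, hz, rfl⟩ := hf
  rintro S hS hc ⟨x, hxS, hx⟩
  rw [connectedComponentIn_eq hx]
  exact hc.subset_connectedComponentIn hxS hS

lemma IsFace.eq_of_inter {f f' : Set ℂ} (hf : G.IsFace f) (hf' : G.IsFace f')
    (h : (f ∩ f').Nonempty) : f = f' :=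
  (hf'.absorbsIn f hf.subset_region hf.isPreconnected h).antisymm
    (hf.absorbsIn f' hf'.subset_region hf'.isPreconnected (inter_comm f f' ▸ h))

lemma blackEnd_ne_whiteEnd (e : E) : G.blackEnd e ≠ G.whiteEnd e := by
  intro h
  obtain ⟨v, hv⟩ := G.exists_internal_end e
  have h1 : G.blackEnd e = Sum.inl v := hv.elim id fun hv => h.trans hv
  have h2 := G.color_blackEnd e v h1
  rw [G.color_whiteEnd e v (h ▸ h1)] at h2
  cases h2

lemma place_blackEnd_mem (e : E) :
    G.place (G.blackEnd e) ∈ segment ℝ (G.pt e 0) (G.pt e (0 + 1)) := by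
  rw [← G.pt_zero]; exact left_mem_segment _ _ _

lemma place_whiteEnd_mem (e : E) :
    G.place (G.whiteEnd e) ∈ segment ℝ (G.pt e (G.len e - 1)) (G.pt e (G.len e - 1 + 1)) := by
  rw [← G.pt_len, Nat.sub_add_cancel (G.len_pos e)]; exact right_mem_segment _ _ _

/-! ### Which segments of the drawing meet at a point -/

section openSegment
variable {e : E} {i : ℕ} {z : ℂ}

lemma ne_left_of_mem_openSegment (hi : i < G.len e)
    (hz : z ∈ openSegment ℝ (G.pt e i) (G.pt e (i + 1))) : z ≠ G.pt e i := by
  rintro rfl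
  exact G.pt_ne e i hi (left_mem_openSegment_iff.1 hz)

lemma ne_right_of_mem_openSegment (hi : i < G.len e)
    (hz : z ∈ openSegment ℝ (G.pt e i) (G.pt e (i + 1))) : z ≠ G.pt e (i + 1) := by
  rintro rfl
  exact G.pt_ne e i hi (right_mem_openSegment_iff.1 hz)

lemma index_eq_of_mem_openSegment (hi : i < G.len e)
    (hz : z ∈ openSegment ℝ (G.pt e i) (G.pt e (i + 1))) {j : ℕ} (hj : j < G.len e)
    (hz' : z ∈ segment ℝ (G.pt e j) (G.pt e (j + 1))) : j = i := by
  have hz0 := openSegment_subset_segment ℝ _ _ hz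
  rcases lt_trichotomy i j with h | h | h
  · obtain ⟨rfl, h2⟩ := G.arc_simple e i j z h hj hz0 hz'
    exact absurd h2 (ne_right_of_mem_openSegment hi hz)
  · exact h.symm
  · obtain ⟨rfl, h2⟩ := G.arc_simple e j i z h hi hz' hz0
    exact absurd h2 (ne_left_of_mem_openSegment hi hz)

lemma ne_place_of_mem_openSegment (hi : i < G.len e)
    (hz : z ∈ openSegment ℝ (G.pt e i) (G.pt e (i + 1))) (w : V ⊕ Fin n) : z ≠ G.place w := by
  rintro rfl
  rcases G.arc_avoids e i w hi (openSegment_subset_segment ℝ _ _ hz) with rfl | rfl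
  · have h := index_eq_of_mem_openSegment hi hz (G.len_pos e) (place_blackEnd_mem e)
    subst h
    exact ne_left_of_mem_openSegment hi hz (G.pt_zero e).symm
  · have h := index_eq_of_mem_openSegment hi hz (Nat.sub_lt (G.len_pos e) one_pos)
      (place_whiteEnd_mem e)
    subst h
    apply ne_right_of_mem_openSegment hi hz
    rw [← G.pt_len]
    exact congrArg _ (Nat.sub_add_cancel (G.len_pos e)).symm

lemma eq_of_mem_openSegment (hi : i < G.len e)
    (hz : z ∈ openSegment ℝ (G.pt e i) (G.pt e (i + 1))) {e' : E} {j : ℕ} (hj : j < G.len e')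
    (hz' : z ∈ segment ℝ (G.pt e' j) (G.pt e' (j + 1))) : e' = e ∧ j = i := by
  have h : e' = e := by
    by_contra hne
    obtain ⟨w, hw⟩ := G.arcs_disjoint e' e j i z hne hj hi hz' (openSegment_subset_segment ℝ _ _ hz)
    exact ne_place_of_mem_openSegment hi hz w hw
  subst h
  exact ⟨rfl, index_eq_of_mem_openSegment hi hz hj hz'⟩

lemma norm_place_le (w : V ⊕ Fin n) : ‖G.place w‖ ≤ 1 := by
  rcases w with v | i
  · exact (G.place_internal v).le
  · rw [G.place_boundary, Complex.norm_exp_ofReal_mul_I]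

lemma norm_pt_le (hi : i ≤ G.len e) : ‖G.pt e i‖ ≤ 1 := by
  rcases Nat.eq_zero_or_pos i with rfl | h0
  · rw [G.pt_zero]; exact norm_place_le _
  rcases hi.eq_or_lt with rfl | h1
  · rw [G.pt_len]; exact norm_place_le _
  · exact (G.pt_inside e i h0 h1).le

lemma norm_pt_lt_or (hi : i < G.len e) : ‖G.pt e i‖ < 1 ∨ ‖G.pt e (i + 1)‖ < 1 := by
  rcases Nat.eq_zero_or_pos i with rfl | h0
  · by_cases h1 : 1 < G.len e
    · exact Or.inr (G.pt_inside e _ one_pos h1)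
    · have h2 : G.len e = 0 + 1 := by have := G.len_pos e; omega
      rw [← h2, G.pt_zero, G.pt_len]
      obtain ⟨v, hv | hv⟩ := G.exists_internal_end e
      · left; rw [hv]; exact G.place_internal v
      · right; rw [hv]; exact G.place_internal v
  · exact Or.inl (G.pt_inside e i h0 hi)

lemma norm_lt_of_mem_openSegment (hi : i < G.len e)
    (hz : z ∈ openSegment ℝ (G.pt e i) (G.pt e (i + 1))) : ‖z‖ < 1 := by
  obtain ⟨a, b, ha, hb, hab, rfl⟩ := hz
  have h1 := norm_pt_le (G := G) (e := e) hi.le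
  have h2 := norm_pt_le (G := G) (e := e) (i := i + 1) hi
  have h3 : ‖a • G.pt e i + b • G.pt e (i + 1)‖ ≤ a * ‖G.pt e i‖ + b * ‖G.pt e (i + 1)‖ := by
    refine (norm_add_le _ _).trans (le_of_eq ?_)
    rw [norm_smul, norm_smul, Real.norm_of_nonneg ha.le, Real.norm_of_nonneg hb.le]
  rcases norm_pt_lt_or (G := G) hi with h | h <;> nlinarith

end openSegment

section corner
variable {e : E} {i : ℕ}

lemma pt_succ_ne_place (hi : i + 1 < G.len e) (w : V ⊕ Fin n) : G.pt e (i + 1) ≠ G.place w := by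
  intro h
  have hm : G.place w ∈ segment ℝ (G.pt e i) (G.pt e (i + 1)) := h ▸ right_mem_segment _ _ _
  rcases G.arc_avoids e i w (by omega) hm with rfl | rfl
  · obtain ⟨h1, h2⟩ := G.arc_simple e 0 (i + 1) _ (by omega) hi (place_blackEnd_mem e)
      (h ▸ left_mem_segment _ _ _)
    rw [← G.pt_zero, h1] at h2
    exact G.pt_ne e 0 (by omega) h2
  · obtain ⟨h1, h2⟩ := G.arc_simple e i (G.len e - 1) _ (by omega) (by omega) hm
      (place_whiteEnd_mem e)
    apply G.pt_ne e (G.len e - 1) (by omega)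
    rw [← h2, Nat.sub_add_cancel (G.len_pos e), G.pt_len]

lemma eq_of_pt_succ_mem_segment (hi : i + 1 < G.len e) {e' : E} {j : ℕ} (hj : j < G.len e')
    (h : G.pt e (i + 1) ∈ segment ℝ (G.pt e' j) (G.pt e' (j + 1))) :
    e' = e ∧ (j = i ∨ j = i + 1) := by
  have h' : e' = e := by
    by_contra hne
    obtain ⟨w, hw⟩ := G.arcs_disjoint e' e j i _ hne hj (by omega) h (right_mem_segment _ _ _)
    exact pt_succ_ne_place hi w hw
  subst h'
  refine ⟨rfl, ?_⟩
  by_contra! hcon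
  have hl : j < i ∨ i + 1 < j := by omega
  rcases hl with hl | hl
  · obtain ⟨h1, -⟩ := G.arc_simple e' j (i + 1) _ (by omega) hi h (left_mem_segment _ _ _)
    omega
  · obtain ⟨h1, h2⟩ := G.arc_simple e' i j _ (by omega) hj (right_mem_segment _ _ _) h
    omega

end corner

lemma eq_zero_of_blackEnd_mem_segment {e : E} {j : ℕ} (hj : j < G.len e)
    (h : G.place (G.blackEnd e) ∈ segment ℝ (G.pt e j) (G.pt e (j + 1))) : j = 0 := by
  by_contra h0
  obtain ⟨h1, h2⟩ := G.arc_simple e 0 j _ (by omega) hj (place_blackEnd_mem e) h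
  rw [← G.pt_zero, h1] at h2
  exact G.pt_ne e 0 (by omega) h2

lemma eq_len_sub_one_of_whiteEnd_mem_segment {e : E} {j : ℕ} (hj : j < G.len e)
    (h : G.place (G.whiteEnd e) ∈ segment ℝ (G.pt e j) (G.pt e (j + 1))) : j = G.len e - 1 := by
  by_contra h0
  obtain ⟨h1, h2⟩ := G.arc_simple e j (G.len e - 1) _ (by omega) (by omega) h (place_whiteEnd_mem e)
  apply G.pt_ne e (G.len e - 1) (by omega)
  rw [← h2, Nat.sub_add_cancel (G.len_pos e), G.pt_len]

/-- Segments of different edges do not leave a common point in the same direction. -/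
lemma eq_of_ray_eq {e e' : E} {i i' : ℕ} (hi : i < G.len e) (hi' : i' < G.len e') {p a b : ℂ}
    (ha : openSegment ℝ p a = openSegment ℝ (G.pt e i) (G.pt e (i + 1)))
    (hb : openSegment ℝ p b = openSegment ℝ (G.pt e' i') (G.pt e' (i' + 1)))
    {c : ℝ} (hc : 0 < c) (h : b - p = c * (a - p)) : e = e' ∧ i = i' := by
  have h1 : p + ((c / (1 + c) : ℝ) : ℂ) * (a - p) ∈ openSegment ℝ p a :=
    add_mul_mem_openSegment ⟨by positivity, by rw [div_lt_one (by positivity)]; linarith⟩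
  have h2 : p + ((1 / (1 + c) : ℝ) : ℂ) * (b - p) ∈ openSegment ℝ p b :=
    add_mul_mem_openSegment ⟨by positivity, by rw [div_lt_one (by positivity)]; linarith⟩
  have h3 : p + ((1 / (1 + c) : ℝ) : ℂ) * (b - p) = p + ((c / (1 + c) : ℝ) : ℂ) * (a - p) := by
    rw [h]; push_cast; ring
  rw [h3, hb] at h2
  rw [ha] at h1
  exact eq_of_mem_openSegment hi' h2 hi (openSegment_subset_segment ℝ _ _ h1)

/-! ### The two sides of an edge -/

lemma isRightFace_iff {e : E} {f : Set ℂ} : G.IsRightFace e f ↔ G.IsFace f ∧ ∀ i < G.len e,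
    ∀ z ∈ openSegment ℝ (G.pt e i) (G.pt e (i + 1)),
      EntersAlong f z (Complex.I * (G.pt e i - G.pt e (i + 1))) := by
  have h : ∀ (z : ℂ) (t : ℝ) (i : ℕ), z - t * (Complex.I * (G.pt e (i + 1) - G.pt e i)) =
      z + t * (Complex.I * (G.pt e i - G.pt e (i + 1))) := fun z t i => by ring
  simp only [IsRightFace, EntersAlong, h]

lemma IsRightFace.unique {e : E} {f f' : Set ℂ} (h : G.IsRightFace e f) (h' : G.IsRightFace e f') :
    f = f' := by
  obtain ⟨z, hz⟩ := openSegment_nonempty (G.pt e 0) (G.pt e (0 + 1))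
  obtain ⟨t, h1, h2⟩ := ((h.2 0 (G.len_pos e) z hz).and (h'.2 0 (G.len_pos e) z hz)).exists
  exact h.1.eq_of_inter h'.1 ⟨_, h1, h2⟩

lemma IsLeftFace.unique {e : E} {f f' : Set ℂ} (h : G.IsLeftFace e f) (h' : G.IsLeftFace e f') :
    f = f' := by
  obtain ⟨z, hz⟩ := openSegment_nonempty (G.pt e 0) (G.pt e (0 + 1))
  obtain ⟨t, h1, h2⟩ := ((h.2 0 (G.len_pos e) z hz).and (h'.2 0 (G.len_pos e) z hz)).exists
  exact h.1.eq_of_inter h'.1 ⟨_, h1, h2⟩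

section sides
variable [Finite V] [Finite E] {e : E} {i : ℕ} {f : Set ℂ}

lemma exists_sector_subset_region (hi : i < G.len e) {z : ℂ}
    (hz : z ∈ openSegment ℝ (G.pt e i) (G.pt e (i + 1))) {d : ℂ}
    (hd : d = G.pt e (i + 1) - G.pt e i ∨ d = G.pt e i - G.pt e (i + 1)) :
    ∃ ε > 0, sector z d Real.pi ε ⊆ G.region := by
  have hd0 : d ≠ 0 := by
    rcases hd with rfl | rfl
    · exact sub_ne_zero.2 (G.pt_ne e i hi).symm
    · exact sub_ne_zero.2 (G.pt_ne e i hi)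
  have hb : Metric.ball (0 : ℂ) 1 ∈ 𝓝 z :=
    Metric.isOpen_ball.mem_nhds (by simpa using norm_lt_of_mem_openSegment hi hz)
  apply exists_sector_pi_subset hd0
  filter_upwards [G.eventually_mem_segment z, hb] with q h1 h2 h3
  refine ⟨h2, fun hq => ?_⟩
  rcases h1 hq with h | ⟨e', j, hj, hz', hq'⟩
  · exact h3 0 (by simp [h])
  · obtain ⟨rfl, rfl⟩ := eq_of_mem_openSegment hi hz hj hz'
    rw [segment_eq_image'] at hz' hq'
    obtain ⟨x, -, rfl⟩ := hz'
    obtain ⟨y, -, rfl⟩ := hq'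
    simp only [Complex.real_smul] at *
    rcases hd with rfl | rfl
    · apply h3 (y - x); push_cast; ring
    · apply h3 (x - y); push_cast; ring

/-- Which face is on the left of a segment can be read off at any of its inner points. -/
lemma entersAlong_left_iff (hf : G.IsFace f) (hi : i < G.len e) {z z' : ℂ}
    (hz : z ∈ openSegment ℝ (G.pt e i) (G.pt e (i + 1)))
    (hz' : z' ∈ openSegment ℝ (G.pt e i) (G.pt e (i + 1))) :
    EntersAlong f z (Complex.I * (G.pt e (i + 1) - G.pt e i)) ↔
      EntersAlong f z' (Complex.I * (G.pt e (i + 1) - G.pt e i)) :=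
  hf.absorbsIn.entersAlong_segment
    (fun _ hy => exists_sector_subset_region hi hy (Or.inl rfl)) hz hz'

lemma entersAlong_right_iff (hf : G.IsFace f) (hi : i < G.len e) {z z' : ℂ}
    (hz : z ∈ openSegment ℝ (G.pt e i) (G.pt e (i + 1)))
    (hz' : z' ∈ openSegment ℝ (G.pt e i) (G.pt e (i + 1))) :
    EntersAlong f z (Complex.I * (G.pt e i - G.pt e (i + 1))) ↔
      EntersAlong f z' (Complex.I * (G.pt e i - G.pt e (i + 1))) := by
  rw [openSegment_symm] at hz hz'
  refine hf.absorbsIn.entersAlong_segment (fun y hy => ?_) hz hz'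
  rw [openSegment_symm] at hy
  exact exists_sector_subset_region hi hy (Or.inr rfl)

/-- At a corner of an edge, both sides of the edge continue. -/
lemma entersAlong_corner (hf : G.IsFace f) (hi : i + 1 < G.len e) {z z' : ℂ}
    (hz : z ∈ openSegment ℝ (G.pt e i) (G.pt e (i + 1)))
    (hz' : z' ∈ openSegment ℝ (G.pt e (i + 1)) (G.pt e (i + 1 + 1))) :
    (EntersAlong f z (Complex.I * (G.pt e (i + 1) - G.pt e i)) ↔
      EntersAlong f z' (Complex.I * (G.pt e (i + 1 + 1) - G.pt e (i + 1)))) ∧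
    (EntersAlong f z (Complex.I * (G.pt e i - G.pt e (i + 1))) ↔
      EntersAlong f z' (Complex.I * (G.pt e (i + 1) - G.pt e (i + 1 + 1)))) := by
  have hi0 : i < G.len e := by omega
  set p := G.pt e (i + 1) with hp
  let u : Bool → ℂ := fun b => if b then G.pt e (i + 1 + 1) - p else G.pt e i - p
  obtain ⟨σ, hσ, hside⟩ := exists_perm_sides (R := G.region) (p := p) (u := u)
    (by
      rintro (_ | _)
      · exact sub_ne_zero.2 (G.pt_ne e i hi0)
      · exact sub_ne_zero.2 (G.pt_ne e (i + 1) hi).symm)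
    (by
      rintro (_ | _) (_ | _) c hc h
      · rfl
      · have := (eq_of_ray_eq hi0 hi (openSegment_symm ℝ p (G.pt e i)) rfl hc h).2
        omega
      · have := (eq_of_ray_eq hi hi0 rfl (openSegment_symm ℝ p (G.pt e i)) hc h).2
        omega
      · rfl)
    (by
      filter_upwards [eventually_mem_region (G := G) (p := p) (G.pt_inside e _ (by omega) hi)]
        with q h1 h2 h3
      refine h1 h2 fun e' j hj hpj s hs => ?_
      obtain ⟨rfl, rfl | rfl⟩ := eq_of_pt_succ_mem_segment hi hj hpj
      · exact ⟨fun _ => h3 false s hs, fun h => absurd rfl h⟩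
      · exact ⟨fun h => absurd rfl h, fun _ => h3 true s hs⟩)
  have hσt : σ true = false := by simpa using hσ true false (by simp)
  have hσf : σ false = true := by simpa using hσ false true (by simp)
  obtain ⟨s, ⟨h1, h2⟩, hs⟩ := (((hside f hf.absorbsIn true).and (hside f hf.absorbsIn false)).and
    (Ioo_mem_nhdsGT (one_pos (α := ℝ)))).exists
  rw [hσt] at h1
  rw [hσf] at h2
  simp only [u, if_true, Bool.false_eq_true, if_false] at h1 h2
  have e1 : -(Complex.I * (G.pt e i - p)) = Complex.I * (p - G.pt e i) := by ring
  have e2 : -(Complex.I * (G.pt e (i + 1 + 1) - p)) = Complex.I * (p - G.pt e (i + 1 + 1)) := by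
    ring
  rw [e1] at h1
  rw [e2] at h2
  have m1 := add_mul_mem_openSegment' (a := G.pt e i) (b := p) hs
  have m2 := add_mul_mem_openSegment (a := p) (b := G.pt e (i + 1 + 1)) hs
  constructor
  · rw [entersAlong_left_iff hf hi0 hz m1, entersAlong_left_iff hf hi hz' m2]
    exact h1.symm
  · rw [entersAlong_right_iff hf hi0 hz m1, entersAlong_right_iff hf hi hz' m2]
    exact h2

/-- The face on the left of an edge can be read off at any inner point of any segment. -/
lemma isLeftFace_iff_entersAlong (hf : G.IsFace f) (hi : i < G.len e) {z : ℂ}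
    (hz : z ∈ openSegment ℝ (G.pt e i) (G.pt e (i + 1))) :
    G.IsLeftFace e f ↔ EntersAlong f z (Complex.I * (G.pt e (i + 1) - G.pt e i)) := by
  have key : ∀ j (hj : j < G.len e) (z : ℂ), z ∈ openSegment ℝ (G.pt e j) (G.pt e (j + 1)) →
      ∀ y ∈ openSegment ℝ (G.pt e 0) (G.pt e (0 + 1)),
      (EntersAlong f y (Complex.I * (G.pt e (0 + 1) - G.pt e 0)) ↔
        EntersAlong f z (Complex.I * (G.pt e (j + 1) - G.pt e j))) := by
    intro j
    induction j with
    | zero => intro hj z hz y hy; exact entersAlong_left_iff hf hj hy hz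
    | succ k ih =>
      intro hj z hz y hy
      obtain ⟨x, hx⟩ := openSegment_nonempty (G.pt e k) (G.pt e (k + 1))
      exact (ih (by omega) x hx y hy).trans (entersAlong_corner hf hj hx hz).1
  obtain ⟨y, hy⟩ := openSegment_nonempty (G.pt e 0) (G.pt e (0 + 1))
  refine ⟨fun h => h.2 i hi z hz, fun h => ⟨hf, fun j hj x hx => ?_⟩⟩
  exact (key j hj x hx y hy).1 ((key i hi z hz y hy).2 h)

lemma isRightFace_iff_entersAlong (hf : G.IsFace f) (hi : i < G.len e) {z : ℂ}
    (hz : z ∈ openSegment ℝ (G.pt e i) (G.pt e (i + 1))) :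
    G.IsRightFace e f ↔ EntersAlong f z (Complex.I * (G.pt e i - G.pt e (i + 1))) := by
  have key : ∀ j (hj : j < G.len e) (z : ℂ), z ∈ openSegment ℝ (G.pt e j) (G.pt e (j + 1)) →
      ∀ y ∈ openSegment ℝ (G.pt e 0) (G.pt e (0 + 1)),
      (EntersAlong f y (Complex.I * (G.pt e 0 - G.pt e (0 + 1))) ↔
        EntersAlong f z (Complex.I * (G.pt e j - G.pt e (j + 1)))) := by
    intro j
    induction j with
    | zero => intro hj z hz y hy; exact entersAlong_right_iff hf hj hy hz
    | succ k ih =>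
      intro hj z hz y hy
      obtain ⟨x, hx⟩ := openSegment_nonempty (G.pt e k) (G.pt e (k + 1))
      exact (ih (by omega) x hx y hy).trans (entersAlong_corner hf hj hx hz).2
  obtain ⟨y, hy⟩ := openSegment_nonempty (G.pt e 0) (G.pt e (0 + 1))
  rw [isRightFace_iff]
  refine ⟨fun h => h.2 i hi z hz, fun h => ⟨hf, fun j hj x hx => ?_⟩⟩
  exact (key j hj x hx y hy).1 ((key i hi z hz y hy).2 h)

lemma exists_isFace_entersAlong (hi : i < G.len e) {z : ℂ}
    (hz : z ∈ openSegment ℝ (G.pt e i) (G.pt e (i + 1))) {d : ℂ}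
    (hd : d = G.pt e (i + 1) - G.pt e i ∨ d = G.pt e i - G.pt e (i + 1)) :
    ∃ f, G.IsFace f ∧ EntersAlong f z (Complex.I * d) := by
  obtain ⟨ε, hε, hR⟩ := exists_sector_subset_region hi hz hd
  have h := entersAlong_sector_pi_apex (p := z) (u := d) hε
  obtain ⟨t, ht⟩ := h.exists
  refine ⟨_, ⟨_, hR ht, rfl⟩, h.mono fun s hs => ?_⟩
  exact (isPreconnected_sector _ _ _ _).subset_connectedComponentIn ht hR hs

lemma exists_isLeftFace (G : PlaneBipartiteGraph n V E) (e : E) : ∃ f, G.IsLeftFace e f := by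
  obtain ⟨z, hz⟩ := openSegment_nonempty (G.pt e 0) (G.pt e (0 + 1))
  obtain ⟨f, hf, h⟩ := exists_isFace_entersAlong (G.len_pos e) hz (Or.inl rfl)
  exact ⟨f, (isLeftFace_iff_entersAlong hf (G.len_pos e) hz).2 h⟩

lemma exists_isRightFace (G : PlaneBipartiteGraph n V E) (e : E) : ∃ f, G.IsRightFace e f := by
  obtain ⟨z, hz⟩ := openSegment_nonempty (G.pt e 0) (G.pt e (0 + 1))
  obtain ⟨f, hf, h⟩ := exists_isFace_entersAlong (G.len_pos e) hz (Or.inr rfl)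
  exact ⟨f, (isRightFace_iff_entersAlong hf (G.len_pos e) hz).2 h⟩

/-- Around an internal vertex, the left side of each edge is the right side of another one. -/
lemma exists_perm_faces_at (G : PlaneBipartiteGraph n V E) (v : V) :
    ∃ σ : Equiv.Perm {e // G.Incident e (Sum.inl v)},
      ∀ f, G.IsFace f → ∀ e, (G.IsLeftFace e.1 f ↔ G.IsRightFace (σ e).1 f) := by
  have hpv := G.place_internal v
  rcases hcol : G.color v with _ | _
  · have hb : ∀ e : {e // G.Incident e (Sum.inl v)}, G.blackEnd e.1 = Sum.inl v := by
      rintro ⟨e, he | he⟩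
      · exact he
      · have := G.color_whiteEnd e v he
        rw [hcol] at this
        cases this
    set p := G.place (Sum.inl v) with hp
    have hp0 : ∀ e : {e // G.Incident e (Sum.inl v)}, G.pt e.1 0 = p := fun e => by
      rw [G.pt_zero, hb e]
    obtain ⟨σ, -, hside⟩ := exists_perm_sides (R := G.region) (p := p)
      (u := fun e : {e // G.Incident e (Sum.inl v)} => G.pt e.1 (0 + 1) - p)
      (by
        intro e
        rw [← hp0 e]
        exact sub_ne_zero.2 (G.pt_ne e.1 0 (G.len_pos _)).symm)
      (by
        intro e e' c hc h
        exact Subtype.ext (eq_of_ray_eq (G.len_pos _) (G.len_pos _) (by rw [hp0 e])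
          (by rw [hp0 e']) hc h).1)
      (by
        filter_upwards [eventually_mem_region (G := G) (p := p) hpv] with q h1 h2 h3
        refine h1 h2 fun e j hj hpj s hs => ?_
        have he : G.Incident e (Sum.inl v) := by
          rcases G.arc_avoids e j _ hj hpj with h | h
          · exact Or.inl h.symm
          · exact Or.inr h.symm
        have hj0 : j = 0 := by
          apply eq_zero_of_blackEnd_mem_segment hj
          rwa [hb ⟨e, he⟩]
        subst hj0
        exact ⟨fun h => absurd (hp0 ⟨e, he⟩) h, fun _ => h3 ⟨e, he⟩ s hs⟩)
    refine ⟨σ, fun f hf e => ?_⟩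
    obtain ⟨s, h1, hs⟩ := ((hside f hf.absorbsIn e).and (Ioo_mem_nhdsGT (one_pos (α := ℝ)))).exists
    have m1 := add_mul_mem_openSegment (a := p) (b := G.pt e.1 (0 + 1)) hs
    have m2 := add_mul_mem_openSegment (a := p) (b := G.pt (σ e).1 (0 + 1)) hs
    rw [← hp0 e] at m1
    rw [← hp0 (σ e)] at m2
    rw [isLeftFace_iff_entersAlong hf (G.len_pos _) m1,
      isRightFace_iff_entersAlong hf (G.len_pos _) m2, hp0, hp0, h1, iff_eq_eq]
    congr 1
    ring
  · have hb : ∀ e : {e // G.Incident e (Sum.inl v)}, G.whiteEnd e.1 = Sum.inl v := by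
      rintro ⟨e, he | he⟩
      · have := G.color_blackEnd e v he
        rw [hcol] at this
        cases this
      · exact he
    set p := G.place (Sum.inl v) with hp
    have hp0 : ∀ e : {e // G.Incident e (Sum.inl v)}, G.pt e.1 (G.len e.1 - 1 + 1) = p :=
      fun e => by rw [Nat.sub_add_cancel (G.len_pos _), G.pt_len, hb e]
    have hl : ∀ e, G.len e - 1 < G.len e := fun e => Nat.sub_lt (G.len_pos e) one_pos
    obtain ⟨σ, -, hside⟩ := exists_perm_sides (R := G.region) (p := p)
      (u := fun e : {e // G.Incident e (Sum.inl v)} => G.pt e.1 (G.len e.1 - 1) - p)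
      (by
        intro e
        rw [← hp0 e]
        exact sub_ne_zero.2 (G.pt_ne e.1 _ (hl _)))
      (by
        intro e e' c hc h
        exact Subtype.ext (eq_of_ray_eq (hl _) (hl _) (by rw [hp0 e, openSegment_symm])
          (by rw [hp0 e', openSegment_symm]) hc h).1)
      (by
        filter_upwards [eventually_mem_region (G := G) (p := p) hpv] with q h1 h2 h3
        refine h1 h2 fun e j hj hpj s hs => ?_
        have he : G.Incident e (Sum.inl v) := by
          rcases G.arc_avoids e j _ hj hpj with h | h
          · exact Or.inl h.symm
          · exact Or.inr h.symm
        have hj0 : j = G.len e - 1 := by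
          apply eq_len_sub_one_of_whiteEnd_mem_segment hj
          rwa [hb ⟨e, he⟩]
        subst hj0
        exact ⟨fun _ => h3 ⟨e, he⟩ s hs, fun h => absurd (hp0 ⟨e, he⟩) h⟩)
    refine ⟨σ⁻¹, fun f hf e' => ?_⟩
    obtain ⟨e, rfl⟩ := σ.surjective e'
    rw [show σ⁻¹ (σ e) = e from σ.symm_apply_apply e]
    obtain ⟨s, h1, hs⟩ := ((hside f hf.absorbsIn e).and (Ioo_mem_nhdsGT (one_pos (α := ℝ)))).exists
    have m1 := add_mul_mem_openSegment' (a := G.pt e.1 (G.len e.1 - 1)) (b := p) hs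
    have m2 := add_mul_mem_openSegment' (a := G.pt (σ e).1 (G.len (σ e).1 - 1)) (b := p) hs
    rw [← hp0 e] at m1
    rw [← hp0 (σ e)] at m2
    rw [isLeftFace_iff_entersAlong hf (hl _) m2,
      isRightFace_iff_entersAlong hf (hl _) m1, hp0, hp0, h1, iff_eq_eq]
    congr 1
    ring

end sides

end PlaneBipartiteGraph

/-! ### Turning angles and closed curves in the disk -/

/-- `A p` is an angle by which the direction from `p` to a moving point turns when the point moves
from `a` to `b` inside the set `S`, as a continuous function of `p ∉ S`. The value for `p` outside
the open unit disk is prescribed, so that it vanishes for a closed curve in the disk. -/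
structure IsTurning (S : Set ℂ) (a b : ℂ) (A : ℂ → ℝ) : Prop where
  left_mem : a ∈ S
  right_mem : b ∈ S
  continuousOn : ContinuousOn A Sᶜ
  exp_eq : ∀ p ∉ S, (b - p) * ‖a - p‖ = (a - p) * ‖b - p‖ * Complex.exp (A p * Complex.I)
  outer : ∀ p : ℂ, 1 ≤ ‖p‖ → A p = Complex.arg ((p - b) / p) - Complex.arg ((p - a) / p)

namespace IsTurning

variable {S T : Set ℂ} {a b c : ℂ} {A B : ℂ → ℝ}

lemma mono (h : IsTurning S a b A) (hST : S ⊆ T) : IsTurning T a b A where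
  left_mem := hST h.left_mem
  right_mem := hST h.right_mem
  continuousOn := h.continuousOn.mono (compl_subset_compl.2 hST)
  exp_eq p hp := h.exp_eq p fun hs => hp (hST hs)
  outer := h.outer

lemma add (h : IsTurning S a b A) (h' : IsTurning S b c B) :
    IsTurning S a c (fun p => A p + B p) where
  left_mem := h.left_mem
  right_mem := h'.right_mem
  continuousOn := h.continuousOn.add h'.continuousOn
  exp_eq p hp := by
    have hb : (‖b - p‖ : ℂ) ≠ 0 := by
      rw [Ne, Complex.ofReal_eq_zero, norm_eq_zero, sub_eq_zero]
      rintro rfl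
      exact hp h.right_mem
    have h1 := h.exp_eq p hp
    have h2 := h'.exp_eq p hp
    apply mul_right_cancel₀ hb
    push_cast
    rw [add_mul, Complex.exp_add]
    linear_combination (‖a - p‖ : ℂ) * h2 + ‖c - p‖ * Complex.exp (B p * Complex.I) * h1
  outer p hp := by rw [h.outer p hp, h'.outer p hp]; ring

lemma neg (h : IsTurning S a b A) : IsTurning S b a (fun p => -A p) where
  left_mem := h.right_mem
  right_mem := h.left_mem
  continuousOn := h.continuousOn.neg
  exp_eq p hp := by
    have h1 := h.exp_eq p hp
    have h2 : Complex.exp (A p * Complex.I) * Complex.exp (((-A p : ℝ) : ℂ) * Complex.I) = 1 := by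
      rw [← Complex.exp_add]; simp
    linear_combination -((a - p) * ‖b - p‖) * h2 - Complex.exp (((-A p : ℝ) : ℂ) * Complex.I) * h1
  outer p hp := by rw [h.outer p hp]; ring

lemma eq_zero_of_one_le_norm (h : IsTurning S a a A) {p : ℂ} (hp : 1 ≤ ‖p‖) : A p = 0 := by
  rw [h.outer p hp, sub_self]

/-- The winding angle of a closed curve is constant on connected sets that avoid the curve. -/
lemma eq_of_isPreconnected (h : IsTurning S a a A) {K : Set ℂ} (hK : IsPreconnected K)
    (hKS : Disjoint K S) {x y : ℂ} (hx : x ∈ K) (hy : y ∈ K) : A x = A y := by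
  have hd : IsDiscrete (AddSubgroup.zmultiples (2 * Real.pi) : Set ℝ) :=
    ⟨inferInstanceAs (DiscreteTopology (AddSubgroup.zmultiples (2 * Real.pi)))⟩
  have hKS' : K ⊆ Sᶜ := hKS.subset_compl_right
  refine hK.constant_of_mapsTo hd (h.continuousOn.mono hKS') (fun p hp => ?_) hx hy
  have ha : a - p ≠ 0 := by
    rw [sub_ne_zero]
    rintro rfl
    exact hKS' hp h.left_mem
  have h1 := h.exp_eq p (hKS' hp)
  have h2 : Complex.exp (A p * Complex.I) = 1 := by
    have hn : (‖a - p‖ : ℂ) ≠ 0 := by simpa using ha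
    apply mul_left_cancel₀ (mul_ne_zero ha hn)
    rw [← h1, mul_one]
  obtain ⟨k, hk⟩ := Complex.exp_eq_one_iff.1 h2
  refine ⟨k, ?_⟩
  have : ((k * (2 * Real.pi) : ℝ) : ℂ) = (A p : ℝ) := by
    apply mul_right_cancel₀ Complex.I_ne_zero
    rw [hk]; push_cast; ring
  simpa using Complex.ofReal_injective this

end IsTurning

lemma div_mem_slitPlane {a b p : ℂ} (hp : p ∉ segment ℝ a b) :
    (b - p) / (a - p) ∈ Complex.slitPlane := by
  rw [Complex.mem_slitPlane_iff_not_le_zero]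
  intro hle
  have ha : a - p ≠ 0 := by
    rw [sub_ne_zero]
    rintro rfl
    exact hp (left_mem_segment _ _ _)
  obtain ⟨r, hr0, hr⟩ : ∃ r : ℝ, 0 ≤ r ∧ (b - p) / (a - p) = -r := by
    rw [Complex.le_def] at hle
    refine ⟨-((b - p) / (a - p)).re, by simpa using hle.1, Complex.ext (by simp) ?_⟩
    simpa using hle.2
  rw [div_eq_iff ha] at hr
  apply hp
  have h1 : (1 + r : ℂ) ≠ 0 := by exact_mod_cast (by positivity : (1 + r) ≠ 0)
  refine ⟨r / (1 + r), 1 / (1 + r), by positivity, by positivity, by field_simp; ring, ?_⟩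
  simp only [Complex.real_smul]
  push_cast
  field_simp
  linear_combination hr

lemma re_pos_of_norm_lt {a p : ℂ} (ha : ‖a‖ < 1) (hp : 1 ≤ ‖p‖) : 0 < ((p - a) / p).re := by
  have hp0 : p ≠ 0 := norm_pos_iff.1 (by linarith)
  have h1 : ‖a / p‖ < 1 := by
    rw [norm_div, div_lt_one (by linarith)]
    linarith
  have h2 : (p - a) / p = 1 - a / p := by field_simp
  rw [h2, Complex.sub_re, Complex.one_re]
  linarith [Complex.re_le_norm (a / p)]

/-- The turning angle for a point that moves along a straight segment. -/
lemma isTurning_segment {S : Set ℂ} {a b : ℂ} (ha : ‖a‖ < 1) (hb : ‖b‖ < 1)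
    (hS : segment ℝ a b ⊆ S) :
    IsTurning S a b (fun p => Complex.arg ((b - p) / (a - p))) where
  left_mem := hS (left_mem_segment _ _ _)
  right_mem := hS (right_mem_segment _ _ _)
  continuousOn := by
    intro p hp
    have hp' : p ∉ segment ℝ a b := fun h => hp (hS h)
    have ha : a - p ≠ 0 := by
      rw [sub_ne_zero]
      rintro rfl
      exact hp' (left_mem_segment _ _ _)
    apply ContinuousAt.continuousWithinAt
    refine ContinuousAt.comp' (f := fun p => (b - p) / (a - p))
      (Complex.continuousAt_arg (div_mem_slitPlane hp')) ?_
    exact (continuousAt_const.sub continuousAt_id).div (continuousAt_const.sub continuousAt_id) ha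
  exp_eq p hp := by
    have ha : a - p ≠ 0 := by
      rw [sub_ne_zero]
      rintro rfl
      exact hp (hS (left_mem_segment _ _ _))
    have h := Complex.norm_mul_exp_arg_mul_I ((b - p) / (a - p))
    have hn : (‖a - p‖ : ℂ) ≠ 0 := by simpa using ha
    rw [norm_div] at h
    generalize Complex.exp _ = z at *
    push_cast at h
    field_simp at h
    linear_combination -h
  outer p hp := by
    have h1 := re_pos_of_norm_lt ha hp
    have h2 := re_pos_of_norm_lt hb hp
    have hp0 : p ≠ 0 := norm_pos_iff.1 (by linarith)
    have n1 : (p - a) / p ≠ 0 := fun h => by simp [h] at h1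
    have n2 : (p - b) / p ≠ 0 := fun h => by simp [h] at h2
    have h3 : (b - p) / (a - p) = (p - b) / p * ((p - a) / p)⁻¹ := by
      rw [← neg_sub p b, ← neg_sub p a, neg_div_neg_eq]
      field_simp
    have a1 := abs_lt.1 (Complex.abs_arg_lt_pi_div_two_iff.2 (Or.inl h1))
    have a2 := abs_lt.1 (Complex.abs_arg_lt_pi_div_two_iff.2 (Or.inl h2))
    have h4 : Complex.arg ((p - a) / p)⁻¹ = -Complex.arg ((p - a) / p) := by
      rw [Complex.arg_inv, if_neg]
      intro h
      linarith [Real.pi_pos]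
    rw [h3, Complex.arg_mul n2 (inv_ne_zero n1), h4]
    · ring
    · rw [h4]
      constructor <;> linarith

lemma exists_isTurning {U : Set ℂ} (hU : IsOpen U) (hc : IsPreconnected U)
    (hb : U ⊆ Metric.ball 0 1) {a b : ℂ} (ha : a ∈ U) (hb' : b ∈ U) :
    ∃ A, IsTurning U a b A := by
  refine hc.induction₂' (fun x y => ∃ A, IsTurning U x y A) ?_ ?_ ha hb'
  · intro x hx
    obtain ⟨δ, hδ, hball⟩ := Metric.isOpen_iff.1 hU x hx
    filter_upwards [nhdsWithin_le_nhds (Metric.ball_mem_nhds x hδ)] with y hy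
    have hs : segment ℝ x y ⊆ U :=
      ((convex_ball x δ).segment_subset (Metric.mem_ball_self hδ) hy).trans hball
    have h := isTurning_segment (by simpa using hb hx) (by simpa using hb (hball hy)) hs
    exact ⟨⟨_, h⟩, ⟨_, h.neg⟩⟩
  · rintro x y z - - - ⟨A, hA⟩ ⟨B, hB⟩
    exact ⟨_, hA.add hB⟩

lemma crossing_quotient {t : ℝ} (ht : 0 < t) (s : ℝ) :
    (t * Complex.I - s) / (-(t * Complex.I) - s) =
      (((s ^ 2 - t ^ 2) / (s ^ 2 + t ^ 2) : ℝ) : ℂ) +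
        ((-(2 * s * t) / (s ^ 2 + t ^ 2) : ℝ) : ℂ) * Complex.I := by
  have h1 : ((s : ℂ) ^ 2 + t ^ 2) ≠ 0 := by
    exact_mod_cast (by positivity : (s ^ 2 + t ^ 2) ≠ 0)
  have h2 : (-(t * Complex.I) - s) ≠ 0 := by
    intro h
    have := congrArg Complex.im h
    simp at this
    exact ht.ne' this
  push_cast
  rw [div_eq_iff h2]
  field_simp
  linear_combination (-2 * s * t ^ 2 : ℂ) * Complex.I_sq

lemma tendsto_crossing_quotient {t : ℝ} (ht : 0 < t) :
    Tendsto (fun s : ℝ => (t * Complex.I - s) / (-(t * Complex.I) - s)) (𝓝 0) (𝓝 (-1)) := by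
  have h2 : (-(t * Complex.I)) ≠ 0 := by
    rw [Ne, neg_eq_zero, mul_eq_zero]
    simp [ht.ne']
  have hc : ContinuousAt (fun s : ℝ => (t * Complex.I - s) / (-(t * Complex.I) - s)) 0 := by
    refine ContinuousAt.div (by fun_prop) (by fun_prop) ?_
    simpa using h2
  have h3 : (t * Complex.I - ((0 : ℝ) : ℂ)) / (-(t * Complex.I) - ((0 : ℝ) : ℂ)) = -1 := by
    rw [Complex.ofReal_zero, sub_zero, sub_zero, div_neg, div_self (neg_ne_zero.1 h2)]
  simpa only [ContinuousAt, h3] using hc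

/-- The angle under which the crossing segment is seen jumps from `π` to `-π` when the observer
crosses that segment. -/
lemma tendsto_arg_crossing_right {t : ℝ} (ht : 0 < t) :
    Tendsto (fun s : ℝ => Complex.arg ((t * Complex.I - s) / (-(t * Complex.I) - s))) (𝓝[>] 0)
      (𝓝 (-Real.pi)) := by
  refine (Complex.tendsto_arg_nhdsWithin_im_neg_of_re_neg_of_im_zero (z := -1) (by simp)
    (by simp)).comp (tendsto_nhdsWithin_iff.2
      ⟨(tendsto_crossing_quotient ht).mono_left nhdsWithin_le_nhds, ?_⟩)
  filter_upwards [self_mem_nhdsWithin] with s hs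
  have hs : 0 < s := hs
  rw [crossing_quotient ht]
  simp only [Complex.add_im, Complex.ofReal_im, Complex.im_ofReal_mul, Complex.I_im]
  have : 0 < 2 * s * t / (s ^ 2 + t ^ 2) := by positivity
  rw [neg_div]
  linarith

lemma tendsto_arg_crossing_left {t : ℝ} (ht : 0 < t) :
    Tendsto (fun s : ℝ => Complex.arg ((t * Complex.I - s) / (-(t * Complex.I) - s))) (𝓝[<] 0)
      (𝓝 Real.pi) := by
  refine (Complex.tendsto_arg_nhdsWithin_im_nonneg_of_re_neg_of_im_zero (z := -1) (by simp)
    (by simp)).comp (tendsto_nhdsWithin_iff.2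
      ⟨(tendsto_crossing_quotient ht).mono_left nhdsWithin_le_nhds, ?_⟩)
  filter_upwards [self_mem_nhdsWithin] with s hs
  have hs : s < 0 := hs
  rw [crossing_quotient ht]
  simp only [Complex.add_im, Complex.ofReal_im, Complex.im_ofReal_mul, Complex.I_im]
  have : 0 < 2 * (-s) * t / (s ^ 2 + t ^ 2) := by
    have : 0 < -s := by linarith
    positivity
  have h : -(2 * s * t) / (s ^ 2 + t ^ 2) = 2 * (-s) * t / (s ^ 2 + t ^ 2) := by ring
  rw [h]
  linarith

namespace PlaneBipartiteGraph

variable {n : ℕ} {V E : Type*} {G : PlaneBipartiteGraph n V E}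

lemma IsFace.disjoint_drawing {f : Set ℂ} (hf : G.IsFace f) : Disjoint f G.drawing :=
  disjoint_left.2 fun _ hz => (hf.subset_region hz).2

lemma IsFace.norm_lt {f : Set ℂ} (hf : G.IsFace f) {z : ℂ} (hz : z ∈ f) : ‖z‖ < 1 := by
  simpa using (hf.subset_region hz).1

/-- A stretch of an edge that a closed curve avoids has the same winding angle at both ends. -/
lemma turning_pt_eq {S : Set ℂ} {a : ℂ} {W : ℂ → ℝ} (hW : IsTurning S a a W) {e : E} {j k : ℕ}
    (hjk : j ≤ k)
    (h : ∀ m, j ≤ m → m < k → Disjoint (segment ℝ (G.pt e m) (G.pt e (m + 1))) S) :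
    W (G.pt e j) = W (G.pt e k) := by
  induction k, hjk using Nat.le_induction with
  | base => rfl
  | succ k hjk ih =>
    rw [ih fun m h1 h2 => h m h1 (by omega)]
    exact hW.eq_of_isPreconnected (convex_segment _ _).isPreconnected (h k hjk (by omega))
      (left_mem_segment _ _ _) (right_mem_segment _ _ _)

/-- An edge can be crossed from the face on its right to the face on its left. When a closed curve
consists of this crossing and a curve that avoids the edge, its winding angle drops by `2π` from
the black end to the white end. -/
lemma exists_crossing {e : E} {f f' : Set ℂ} (hl : G.IsLeftFace e f) (hr : G.IsRightFace e f') :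
    ∃ z₀ ∈ openSegment ℝ (G.pt e 0) (G.pt e (0 + 1)), ∃ a ∈ f', ∃ b ∈ f, ∃ C,
      IsTurning (insert z₀ (f ∪ f')) a b C ∧
      ∀ T R, f ⊆ T → f' ⊆ T →
        (∀ j < G.len e, Disjoint (segment ℝ (G.pt e j) (G.pt e (j + 1))) T) →
        IsTurning T b a R →
        C (G.place (G.whiteEnd e)) + R (G.place (G.whiteEnd e)) -
          (C (G.place (G.blackEnd e)) + R (G.place (G.blackEnd e))) = -(2 * Real.pi) := by
  set p := G.pt e 0 with hp
  set d := G.pt e (0 + 1) - p with hd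
  have hd0 : d ≠ 0 := sub_ne_zero.2 (G.pt_ne e 0 (G.len_pos e)).symm
  set z₀ := p + ((1 / 2 : ℝ) : ℂ) * d with hz₀
  have hz : z₀ ∈ openSegment ℝ (G.pt e 0) (G.pt e (0 + 1)) :=
    add_mul_mem_openSegment (by norm_num)
  have h1 := hl.2 0 (G.len_pos e) z₀ hz
  have h2 := hr.2 0 (G.len_pos e) z₀ hz
  obtain ⟨t, ht, ht'⟩ := (mem_nhdsGT_iff_exists_Ioc_subset.1 (h1.and h2))
  have ht : 0 < t := ht
  have htl : ∀ s : ℝ, 0 < s → s ≤ t → z₀ + s * (Complex.I * d) ∈ f := fun s h h' => (ht' ⟨h, h'⟩).1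
  have htr : ∀ s : ℝ, 0 < s → s ≤ t → z₀ - s * (Complex.I * d) ∈ f' :=
    fun s h h' => (ht' ⟨h, h'⟩).2
  have hseg : segment ℝ (z₀ - t * (Complex.I * d)) (z₀ + t * (Complex.I * d)) ⊆
      insert z₀ (f ∪ f') := by
    rw [segment_eq_image']
    rintro _ ⟨x, hx, rfl⟩
    rcases lt_trichotomy x (1 / 2) with h | rfl | h
    · right; right
      have := htr (t * (1 - 2 * x)) (mul_pos ht (by linarith)) (by nlinarith [hx.1])
      convert this using 1
      simp only [Complex.real_smul]; push_cast; ring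
    · left
      simp only [Complex.real_smul]; push_cast; ring
    · right; left
      have := htl (t * (2 * x - 1)) (mul_pos ht (by linarith)) (by nlinarith [hx.2])
      convert this using 1
      simp only [Complex.real_smul]; push_cast; ring
  have hC := isTurning_segment (hr.1.norm_lt (htr t ht le_rfl))
    (hl.1.norm_lt (htl t ht le_rfl)) hseg
  refine ⟨z₀, hz, _, htr t ht le_rfl, _, htl t ht le_rfl, _, hC, ?_⟩
  intro T R hfT hf'T hT hR
  have hW := (hC.mono (show _ ⊆ insert z₀ T from
    insert_subset_insert (union_subset hfT hf'T))).add (hR.mono (subset_insert _ _))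
  set W : ℂ → ℝ := fun q => Complex.arg ((z₀ + t * (Complex.I * d) - q) /
    (z₀ - t * (Complex.I * d) - q)) + R q with hWdef
  change W _ - W _ = _
  -- the winding angle is constant before and after the crossing point
  have hline : ∀ x ∈ Icc (0 : ℝ) 1, x ≠ 1 / 2 → p + x * d ∉ insert z₀ T := by
    intro x hx hne hmem
    have hm : p + x * d ∈ segment ℝ (G.pt e 0) (G.pt e (0 + 1)) := by
      rw [segment_eq_image']
      exact ⟨x, hx, by simp [hd, hp]⟩
    rcases hmem with hmem | hmem
    · have := mul_right_cancel₀ hd0 (add_left_cancel hmem)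
      exact hne (Complex.ofReal_injective this)
    · exact disjoint_left.1 (hT 0 (G.len_pos e)) hm hmem
  have hcont : Continuous fun x : ℝ => p + x * d := by fun_prop
  have hW1 : ∀ x ∈ Ico (0 : ℝ) (1 / 2), W (p + x * d) = W (G.place (G.blackEnd e)) := by
    intro x hx
    have := hW.eq_of_isPreconnected (isPreconnected_Ico.image _ hcont.continuousOn) (by
      rw [disjoint_left]
      rintro _ ⟨y, hy, rfl⟩
      exact hline y ⟨hy.1, by linarith [hy.2]⟩ hy.2.ne) (mem_image_of_mem _ hx)
      (mem_image_of_mem _ (left_mem_Ico.2 (by norm_num : (0 : ℝ) < 1 / 2)))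
    rw [this, ← G.pt_zero, ← hp]
    simp
  have hW2 : ∀ x ∈ Ioc (1 / 2 : ℝ) 1, W (p + x * d) = W (G.place (G.whiteEnd e)) := by
    intro x hx
    have := hW.eq_of_isPreconnected (isPreconnected_Ioc.image _ hcont.continuousOn) (by
      rw [disjoint_left]
      rintro _ ⟨y, hy, rfl⟩
      exact hline y ⟨by linarith [hy.1], hy.2⟩ hy.1.ne') (mem_image_of_mem _ hx)
      (mem_image_of_mem _ (right_mem_Ioc.2 (by norm_num : (1 / 2 : ℝ) < 1)))
    rw [this, ← G.pt_len, ← turning_pt_eq (e := e) hW (G.len_pos e)]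
    · simp [hd]
    · intro m hm0 hm
      rw [disjoint_insert_right]
      refine ⟨fun hz' => ?_, hT m hm⟩
      have := index_eq_of_mem_openSegment (G.len_pos e) hz hm hz'
      omega
  -- compare both values with the one-sided limits at the crossing point
  have hRc : Tendsto (fun s : ℝ => R (z₀ + s * d)) (𝓝 0) (𝓝 (R z₀)) := by
    have hzT : ∀ s ∈ Ioo (-(1 / 2) : ℝ) (1 / 2), z₀ + s * d ∈ Tᶜ := by
      intro s hs
      refine disjoint_left.1 (hT 0 (G.len_pos e)) ?_
      rw [segment_eq_image']
      refine ⟨1 / 2 + s, ⟨by linarith [hs.1], by linarith [hs.2]⟩, ?_⟩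
      simp only [Complex.real_smul, hz₀, hd, hp]; push_cast; ring
    have h0 : z₀ ∈ Tᶜ := by simpa using hzT 0 (by norm_num)
    refine (hR.continuousOn z₀ h0).tendsto.comp (tendsto_nhdsWithin_iff.2 ⟨?_, ?_⟩)
    · have : ContinuousAt (fun s : ℝ => z₀ + s * d) 0 := by fun_prop
      simpa [ContinuousAt] using this
    · filter_upwards [Ioo_mem_nhds (by norm_num : (-(1 / 2) : ℝ) < 0)
        (by norm_num : (0 : ℝ) < 1 / 2)] with s hs
      exact hzT s hs
  have hWs : ∀ s : ℝ, W (p + ((1 / 2 + s : ℝ) : ℂ) * d) =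
      Complex.arg ((t * Complex.I - s) / (-(t * Complex.I) - s)) + R (z₀ + s * d) := by
    intro s
    have e1 : p + ((1 / 2 + s : ℝ) : ℂ) * d = z₀ + s * d := by rw [hz₀]; push_cast; ring
    have e2 : z₀ + t * (Complex.I * d) - (z₀ + s * d) = (t * Complex.I - s) * d := by ring
    have e3 : z₀ - t * (Complex.I * d) - (z₀ + s * d) = (-(t * Complex.I) - s) * d := by ring
    rw [e1, hWdef]
    simp only
    rw [e2, e3, mul_div_mul_right _ _ hd0]
  have lim1 := (tendsto_arg_crossing_left ht).add (hRc.mono_left (nhdsWithin_le_nhds (s := Iio 0)))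
  have lim2 := (tendsto_arg_crossing_right ht).add (hRc.mono_left (nhdsWithin_le_nhds (s := Ioi 0)))
  have v1 : W (G.place (G.blackEnd e)) = Real.pi + R z₀ := by
    refine tendsto_nhds_unique (tendsto_const_nhds.congr' ?_) lim1
    filter_upwards [Ioo_mem_nhdsLT (by norm_num : (-(1 / 2) : ℝ) < 0)] with s hs
    rw [← hWs, hW1]
    constructor <;> linarith [hs.1, hs.2]
  have v2 : W (G.place (G.whiteEnd e)) = -Real.pi + R z₀ := by
    refine tendsto_nhds_unique (tendsto_const_nhds.congr' ?_) lim2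
    filter_upwards [Ioo_mem_nhdsGT (by norm_num : (0 : ℝ) < 1 / 2)] with s hs
    rw [← hWs, hW2]
    constructor <;> linarith [hs.1, hs.2]
  rw [v1, v2]
  ring

lemma IsFace.disjoint_segment {f : Set ℂ} (hf : G.IsFace f) {e : E} {j : ℕ} (hj : j < G.len e) :
    Disjoint (segment ℝ (G.pt e j) (G.pt e (j + 1))) f :=
  (hf.disjoint_drawing.mono_right (segment_subset_drawing hj)).symm

lemma turning_ends_eq {S : Set ℂ} {a : ℂ} {W : ℂ → ℝ} (hW : IsTurning S a a W) {e : E}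
    (h : ∀ m < G.len e, Disjoint (segment ℝ (G.pt e m) (G.pt e (m + 1))) S) :
    W (G.place (G.blackEnd e)) = W (G.place (G.whiteEnd e)) := by
  rw [← G.pt_zero, ← G.pt_len]
  exact turning_pt_eq hW (Nat.zero_le _) fun m _ hm => h m hm

lemma one_le_norm_place (i : Fin n) : 1 ≤ ‖G.place (Sum.inr i)‖ := by
  rw [G.place_boundary, Complex.norm_exp_ofReal_mul_I]

/-- A potential on the vertices, zero on the boundary, whose differences along edges are given by
the function `c` on edges. -/
def IsPotential (G : PlaneBipartiteGraph n V E) (h : V ⊕ Fin n → ℝ) (c : E → ℝ) : Prop :=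
  (∀ i, h (Sum.inr i) = 0) ∧ ∀ e, h (G.blackEnd e) - h (G.whiteEnd e) = c e

variable [Finite V] [Finite E]

open Classical in
/-- An edge with the same face on both sides is crossed by a closed curve that meets no other edge;
the winding angle around this curve is the potential. -/
lemma exists_potential_of_same_face {e : E} {f : Set ℂ} (hl : G.IsLeftFace e f)
    (hr : G.IsRightFace e f) :
    ∃ h, G.IsPotential h (fun a => if a = e then 2 * Real.pi else 0) := by
  obtain ⟨z, hz, a, ha, b, hb, C, hC, hjump⟩ := exists_crossing hl hr
  rw [union_self] at hC
  obtain ⟨R, hR⟩ := exists_isTurning hl.1.isOpen hl.1.isPreconnected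
    (hl.1.subset_region.trans sdiff_subset) hb ha
  have hW := hC.add (hR.mono (subset_insert z f))
  refine ⟨fun w => C (G.place w) + R (G.place w), fun i => ?_, fun a => ?_⟩
  · exact hW.eq_zero_of_one_le_norm (one_le_norm_place i)
  · simp only
    by_cases hae : a = e
    · subst hae
      rw [if_pos rfl]
      have := hjump f R subset_rfl subset_rfl (fun j hj => hl.1.disjoint_segment hj) hR
      linarith
    · rw [if_neg hae, sub_eq_zero]
      refine turning_ends_eq hW fun m hm => ?_
      rw [disjoint_insert_right]
      exact ⟨fun h => hae (eq_of_mem_openSegment (G.len_pos e) hz hm h).1,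
        hl.1.disjoint_segment hm⟩

open Classical in
/-- The potential is the winding angle of a closed curve that crosses `e` from right to left, runs
through the left face to `e'`, crosses `e'` from left to right and returns through the right face.
-/
lemma exists_potential_of_equivalent {e e' : E} (he : G.Equivalent e e') (hne : e ≠ e') :
    ∃ h, G.IsPotential h
      (fun a => if a = e then 2 * Real.pi else if a = e' then -(2 * Real.pi) else 0) := by
  obtain ⟨f, f', ⟨-, hl, hr⟩, -, hl', hr'⟩ := he
  obtain ⟨z, hz, a, ha, b, hb, C, hC, hjump⟩ := exists_crossing hl hr
  obtain ⟨z', hz', a', ha', b', hb', C', hC', hjump'⟩ := exists_crossing hl' hr'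
  obtain ⟨P, hP⟩ := exists_isTurning hl.1.isOpen hl.1.isPreconnected
    (hl.1.subset_region.trans sdiff_subset) hb hb'
  obtain ⟨Q, hQ⟩ := exists_isTurning hr.1.isOpen hr.1.isPreconnected
    (hr.1.subset_region.trans sdiff_subset) ha' ha
  have hdis : ∀ (c : E) (y : ℂ), (∀ j < G.len c, y ∉ segment ℝ (G.pt c j) (G.pt c (j + 1))) →
      ∀ j < G.len c, Disjoint (segment ℝ (G.pt c j) (G.pt c (j + 1))) (insert y (f ∪ f')) := by
    intro c y hy j hj
    rw [disjoint_insert_right, disjoint_union_right]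
    exact ⟨hy j hj, hl.1.disjoint_segment hj, hr.1.disjoint_segment hj⟩
  have hfz : ∀ y, f ⊆ insert y (f ∪ f') := fun y => subset_union_left.trans (subset_insert _ _)
  have hfz' : ∀ y, f' ⊆ insert y (f ∪ f') := fun y => subset_union_right.trans (subset_insert _ _)
  have hR := ((hP.mono (hfz z')).add hC'.neg).add (hQ.mono (hfz' z'))
  have hR' := ((hP.neg.mono (hfz z)).add hC.neg).add (hQ.neg.mono (hfz' z))
  have hW := (hC.mono (insert_subset_insert (subset_insert z' (f ∪ f')))).add
    (hR.mono (subset_insert z _))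
  refine ⟨fun w => C (G.place w) + (P (G.place w) + -C' (G.place w) + Q (G.place w)),
    fun i => hW.eq_zero_of_one_le_norm (one_le_norm_place i), fun c => ?_⟩
  simp only
  by_cases hce : c = e
  · subst hce
    rw [if_pos rfl]
    have := hjump _ _ (hfz z') (hfz' z') (hdis c z' fun j hj h =>
      hne (eq_of_mem_openSegment (G.len_pos e') hz' hj h).1) hR
    linarith
  · by_cases hce' : c = e'
    · subst hce'
      rw [if_neg hce, if_pos rfl]
      have := hjump' _ _ (hfz z) (hfz' z) (hdis c z fun j hj h =>
        hce (eq_of_mem_openSegment (G.len_pos e) hz hj h).1) hR'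
      linarith
    · rw [if_neg hce, if_neg hce', sub_eq_zero]
      refine turning_ends_eq hW fun m hm => ?_
      rw [disjoint_insert_right]
      exact ⟨fun h => hce (eq_of_mem_openSegment (G.len_pos e) hz hm h).1,
        hdis c z' (fun j hj h => hce' (eq_of_mem_openSegment (G.len_pos e') hz' hj h).1) m hm⟩

end PlaneBipartiteGraph

/-! ### Balanced edge vectors and fractional matchings -/

/-- A bipartite incidence structure in which every vertex has degree at least two carries a nonzero
edge vector with vanishing vertex sums: there are at least as many edges as vertices, and in case of
equality the signed sum of the vertex equations is a linear dependence. -/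
lemma exists_ne_zero_balanced {S T : Type*} [Fintype S] [Fintype T] [Nonempty S]
    (inc : S → T → Prop) [∀ e v, Decidable (inc e v)] (c : T → Prop) [DecidablePred c]
    (hdeg : ∀ v, 2 ≤ (Finset.univ.filter fun e => inc e v).card)
    (hinc : ∀ e v v', inc e v → inc e v' → (c v ↔ c v') → v = v') :
    ∃ y : S → ℝ, y ≠ 0 ∧ ∀ v, ∑ e with inc e v, y e = 0 := by
  by_contra! hcon
  let Φ : (S → ℝ) →ₗ[ℝ] (T → ℝ) :=
    LinearMap.pi fun v => ∑ e with inc e v, LinearMap.proj e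
  have hΦ : ∀ y v, Φ y v = ∑ e with inc e v, y e := fun y v => by simp [Φ]
  have hinj : Function.Injective Φ := by
    rw [← LinearMap.ker_eq_bot, LinearMap.ker_eq_bot']
    intro y hy
    by_contra hne
    obtain ⟨v, hv⟩ := hcon y hne
    rw [← hΦ, hy] at hv
    exact hv rfl
  have hST : Fintype.card S ≤ Fintype.card T := by
    simpa using LinearMap.finrank_le_finrank_of_injective hinj
  have hb : ∀ e, (Finset.univ.filter fun v => inc e v ∧ c v).card ≤ 1 := fun e =>
    Finset.card_le_one.2 fun v hv v' hv' => by
      simp only [Finset.mem_filter, Finset.mem_univ, true_and] at hv hv'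
      exact hinc e v v' hv.1 hv'.1 (iff_of_true hv.2 hv'.2)
  have hw : ∀ e, (Finset.univ.filter fun v => inc e v ∧ ¬ c v).card ≤ 1 := fun e =>
    Finset.card_le_one.2 fun v hv v' hv' => by
      simp only [Finset.mem_filter, Finset.mem_univ, true_and] at hv hv'
      exact hinc e v v' hv.1 hv'.1 (iff_of_false hv.2 hv'.2)
  have hbw : ∀ e, (Finset.univ.filter fun v => inc e v).card =
      (Finset.univ.filter fun v => inc e v ∧ c v).card +
        (Finset.univ.filter fun v => inc e v ∧ ¬ c v).card := fun e => by
    rw [← Finset.filter_filter, ← Finset.filter_filter, Finset.card_filter_add_card_filter_not]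
  have hcount : ∑ v, (Finset.univ.filter fun e => inc e v).card =
      ∑ e, (Finset.univ.filter fun v => inc e v).card := by
    simp only [Finset.card_filter]
    exact Finset.sum_comm
  have hT : Fintype.card T * 2 ≤ ∑ v, (Finset.univ.filter fun e => inc e v).card := by
    simpa using Finset.card_nsmul_le_sum Finset.univ _ 2 fun v _ => hdeg v
  have hle : ∀ e ∈ Finset.univ, (Finset.univ.filter fun v => inc e v).card ≤ 2 := fun e _ => by
    rw [hbw]; linarith [hb e, hw e]
  have hsum : ∑ e, (Finset.univ.filter fun v => inc e v).card = ∑ _e : S, 2 := by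
    refine le_antisymm (Finset.sum_le_sum hle) ?_
    simp only [Finset.sum_const, Finset.card_univ, smul_eq_mul]
    rw [← hcount]
    omega
  have htwo := (Finset.sum_eq_sum_iff_of_le hle).1 hsum
  have hcard : Fintype.card S = Fintype.card T := by
    simp only [Finset.sum_const, Finset.card_univ, smul_eq_mul] at hsum
    omega
  have hsurj : Function.Surjective Φ :=
    (LinearMap.injective_iff_surjective_of_finrank_eq_finrank (by simpa using hcard)).1 hinj
  obtain ⟨y, hy⟩ := hsurj fun v => if c v then 1 else -1
  have h0 : ∑ v, (if c v then (1 : ℝ) else -1) * Φ y v = 0 := by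
    simp only [hΦ, Finset.mul_sum, Finset.sum_filter]
    rw [Finset.sum_comm]
    refine Finset.sum_eq_zero fun e _ => ?_
    have h1 : ∀ v, (if c v then (1 : ℝ) else -1) * (if inc e v then y e else 0) =
        y e * ((if inc e v ∧ c v then 1 else 0) - (if inc e v ∧ ¬ c v then 1 else 0)) := by
      intro v
      by_cases h : inc e v <;> by_cases h' : c v <;> simp [h, h']
    simp only [h1]
    rw [← Finset.mul_sum, Finset.sum_sub_distrib, Finset.sum_boole, Finset.sum_boole]
    have := htwo e (Finset.mem_univ e)
    rw [hbw] at this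
    have h2 := hb e
    have h3 := hw e
    rw [show (Finset.univ.filter fun v => inc e v ∧ c v).card = 1 by omega,
      show (Finset.univ.filter fun v => inc e v ∧ ¬ c v).card = 1 by omega]
    simp
  rw [hy] at h0
  have h1 : ∀ v, (if c v then (1 : ℝ) else -1) * (if c v then (1 : ℝ) else -1) = 1 := by
    intro v; split_ifs <;> norm_num
  simp only [h1] at h0
  simp at h0
  exact Fintype.card_ne_zero (hcard.trans h0)

/-- A point of a convex set of nonnegative vectors that is positive in all coordinates in which some
point of the set is. -/
lemma exists_pos_of_convex {E : Type*} [Finite E] {K : Set (E → ℝ)} (hK : Convex ℝ K)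
    (h0 : K.Nonempty) (hpos : ∀ x ∈ K, ∀ e, 0 ≤ x e) {H : Set E}
    (hH : ∀ e ∈ H, ∃ x ∈ K, x e ≠ 0) : ∃ x ∈ K, ∀ e ∈ H, 0 < x e := by
  induction H, H.toFinite using Set.Finite.induction_on with
  | empty => exact ⟨_, h0.some_mem, by simp⟩
  | insert _ _ ih =>
    obtain ⟨x, hx, hx'⟩ := ih fun e he => hH e (mem_insert_of_mem _ he)
    obtain ⟨y, hy, hy'⟩ := hH _ (mem_insert _ _)
    refine ⟨(1 / 2 : ℝ) • x + (1 / 2 : ℝ) • y,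
      hK hx hy (by norm_num) (by norm_num) (by norm_num), ?_⟩
    rintro e (rfl | he)
    · have h1 := lt_of_le_of_ne (hpos y hy e) hy'.symm
      have h2 := hpos x hx e
      simp only [Pi.add_apply, Pi.smul_apply, smul_eq_mul]
      linarith
    · have h1 := hx' e he
      have h2 := hpos y hy e
      simp only [Pi.add_apply, Pi.smul_apply, smul_eq_mul]
      linarith

lemma vectorSpan_eq_of_forall {M : Type*} [AddCommGroup M] [Module ℝ M] {F : Set M} {x : M}
    (hx : x ∈ F) {W : Submodule ℝ M} (h1 : ∀ y ∈ F, y - x ∈ W)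
    (h2 : ∀ w ∈ W, ∃ t : ℝ, t ≠ 0 ∧ x + t • w ∈ F) : vectorSpan ℝ F = W := by
  apply le_antisymm
  · rw [vectorSpan_def, Submodule.span_le]
    rintro _ ⟨y, hy, z, hz, rfl⟩
    have := W.sub_mem (h1 y hy) (h1 z hz)
    simpa using this
  · intro w hw
    obtain ⟨t, ht, h⟩ := h2 w hw
    have h3 := vsub_mem_vectorSpan ℝ h hx
    rw [vsub_eq_sub, add_sub_cancel_left] at h3
    have := (vectorSpan ℝ F).smul_mem t⁻¹ h3
    rwa [inv_smul_smul₀ ht] at this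

namespace PlaneBipartiteGraph

variable {n : ℕ} {V E : Type*} {G : PlaneBipartiteGraph n V E}

lemma exists_incident (e : E) : ∃ v, G.Incident e (Sum.inl v) := G.exists_internal_end e

/-- The boundary of the face `f` as an edge vector: `1` on edges with `f` on their left only, `-1`
on edges with `f` on their right only, and `0` on all other edges. -/
noncomputable def boundaryVector (f : Set ℂ) (G : PlaneBipartiteGraph n V E) (e : E) : ℝ :=
  indicator {e | G.IsLeftFace e f} 1 e - indicator {e | G.IsRightFace e f} 1 e

lemma boundaryVector_of_left {e : E} {f f' : Set ℂ} (h : G.Separates e f f') :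
    boundaryVector f G e = 1 := by
  rw [boundaryVector, indicator_of_mem (show e ∈ {e | G.IsLeftFace e f} from h.2.1),
    indicator_of_notMem (show e ∉ {e | G.IsRightFace e f} from fun h' => h.1 (h'.unique h.2.2))]
  simp

lemma boundaryVector_of_right {e : E} {f f' : Set ℂ} (h : G.Separates e f f') :
    boundaryVector f' G e = -1 := by
  rw [boundaryVector, indicator_of_mem (show e ∈ {e | G.IsRightFace e f'} from h.2.2),
    indicator_of_notMem (show e ∉ {e | G.IsLeftFace e f'} from fun h' => h.1 (h.2.1.unique h'))]
  simp

lemma isLeftFace_of_boundaryVector {e : E} {f : Set ℂ} (h : boundaryVector f G e = 1) :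
    G.IsLeftFace e f := by
  by_contra h'
  rw [boundaryVector, indicator_of_notMem (show e ∉ {e | G.IsLeftFace e f} from h')] at h
  have : (0 : ℝ) ≤ indicator {e | G.IsRightFace e f} 1 e :=
    indicator_nonneg (fun _ _ => zero_le_one) e
  linarith

lemma isRightFace_of_boundaryVector {e : E} {f : Set ℂ} (h : boundaryVector f G e = -1) :
    G.IsRightFace e f := by
  by_contra h'
  rw [boundaryVector, indicator_of_notMem (show e ∉ {e | G.IsRightFace e f} from h')] at h
  have : (0 : ℝ) ≤ indicator {e | G.IsLeftFace e f} 1 e :=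
    indicator_nonneg (fun _ _ => zero_le_one) e
  linarith

lemma convex_faceOfSubgraph (G : PlaneBipartiteGraph n V E) (H : Set E) :
    Convex ℝ (G.faceOfSubgraph H) := by
  intro x hx y hy a b ha hb hab
  refine ⟨convex_convexHull ℝ _ hx.1 hy.1 ha hb hab, fun e he => ?_⟩
  simp [hx.2 e he, hy.2 e he]

lemma faceOfSubgraph_univ (G : PlaneBipartiteGraph n V E) :
    G.faceOfSubgraph univ = G.matchingPolytope := by
  ext x; simp [faceOfSubgraph]

variable [Fintype E]

open Classical in
/-- The sum of the coordinates of an edge vector over the edges at the internal vertex `v`. -/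
noncomputable def vertexSum (G : PlaneBipartiteGraph n V E) (v : V) : (E → ℝ) →ₗ[ℝ] ℝ :=
  ∑ e with G.Incident e (Sum.inl v), LinearMap.proj e

open Classical in
lemma vertexSum_apply (v : V) (x : E → ℝ) :
    G.vertexSum v x = ∑ e with G.Incident e (Sum.inl v), x e := by
  simp [vertexSum]

/-- The edge vectors all of whose vertex sums vanish. -/
noncomputable def balancedVectors (G : PlaneBipartiteGraph n V E) : Submodule ℝ (E → ℝ) :=
  ⨅ v, LinearMap.ker (G.vertexSum v)

lemma mem_balancedVectors {y : E → ℝ} : y ∈ G.balancedVectors ↔ ∀ v, G.vertexSum v y = 0 := by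
  simp [balancedVectors]

/-- The nonnegative edge vectors all of whose vertex sums are `1`. -/
def fractionalMatchings (G : PlaneBipartiteGraph n V E) : Set (E → ℝ) :=
  {x | (∀ e, 0 ≤ x e) ∧ ∀ v, G.vertexSum v x = 1}

lemma IsAlmostPerfectMatching.indicator_mem {M : Set E} (hM : G.IsAlmostPerfectMatching M) :
    M.indicator 1 ∈ G.fractionalMatchings := by
  classical
  refine ⟨fun e => indicator_nonneg (fun _ _ => zero_le_one) e, fun v => ?_⟩
  obtain ⟨e, ⟨he, hev⟩, huniq⟩ := hM v
  rw [vertexSum_apply, Finset.sum_eq_single e]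
  · simp [he]
  · intro e' he' hne
    apply indicator_of_notMem
    intro hM'
    exact hne (huniq e' ⟨hM', by simpa using he'⟩)
  · intro h
    simp [hev] at h

lemma convex_fractionalMatchings : Convex ℝ G.fractionalMatchings := by
  intro x hx y hy a b ha hb hab
  refine ⟨fun e => ?_, fun v => ?_⟩
  · simp only [Pi.add_apply, Pi.smul_apply, smul_eq_mul]
    exact add_nonneg (mul_nonneg ha (hx.1 e)) (mul_nonneg hb (hy.1 e))
  · rw [map_add, map_smul, map_smul, hx.2, hy.2]
    simpa using hab

lemma add_le_one_of_mem {x : E → ℝ} (hx : x ∈ G.fractionalMatchings) {e e' : E} (hne : e ≠ e')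
    {v : V} (he : G.Incident e (Sum.inl v)) (he' : G.Incident e' (Sum.inl v)) :
    x e + x e' ≤ 1 := by
  classical
  rw [← hx.2 v, vertexSum_apply, ← Finset.sum_pair hne]
  refine Finset.sum_le_sum_of_subset_of_nonneg ?_ fun a _ _ => hx.1 a
  intro a ha
  simp only [Finset.mem_insert, Finset.mem_singleton] at ha
  rcases ha with rfl | rfl <;> simpa

lemma le_one_of_mem {x : E → ℝ} (hx : x ∈ G.fractionalMatchings) (e : E) : x e ≤ 1 := by
  classical
  obtain ⟨v, hv⟩ := G.exists_incident e
  rw [← hx.2 v, vertexSum_apply]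
  exact Finset.single_le_sum (f := x) (fun a _ => hx.1 a) (by simpa using hv)

lemma isCompact_fractionalMatchings : IsCompact G.fractionalMatchings := by
  refine (isCompact_univ_pi fun _ : E => isCompact_Icc (a := (0 : ℝ)) (b := 1)).of_isClosed_subset
    ?_ fun x hx e _ => ⟨hx.1 e, le_one_of_mem hx e⟩
  have h : G.fractionalMatchings =
      (⋂ e, {x | 0 ≤ x e}) ∩ ⋂ v, {x | G.vertexSum v x = 1} := by
    ext x; simp [fractionalMatchings]
  rw [h]
  refine (isClosed_iInter fun e => isClosed_le continuous_const (continuous_apply e)).inter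
    (isClosed_iInter fun v => isClosed_eq ?_ continuous_const)
  exact (G.vertexSum v).continuous_of_finiteDimensional

/-- A fractional matching can be moved a little in any balanced direction supported on its
support. -/
lemma eventually_add_smul_mem {x y : E → ℝ} (hx : x ∈ G.fractionalMatchings)
    (hy : y ∈ G.balancedVectors) (h : ∀ e, x e = 0 → y e = 0) :
    ∀ᶠ t : ℝ in 𝓝 0, x + t • y ∈ G.fractionalMatchings := by
  have h1 : ∀ᶠ t : ℝ in 𝓝 0, ∀ e, 0 ≤ (x + t • y) e := by
    rw [eventually_all]
    intro e
    by_cases h0 : x e = 0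
    · simp [h0, h e h0]
    · have hc : ContinuousAt (fun t : ℝ => (x + t • y) e) 0 := by
        simp only [Pi.add_apply, Pi.smul_apply, smul_eq_mul]
        fun_prop
      have hpos : 0 < (x + (0 : ℝ) • y) e := by
        simpa using lt_of_le_of_ne (hx.1 e) (Ne.symm h0)
      exact (hc.eventually_const_lt hpos).mono fun t ht => ht.le
  filter_upwards [h1] with t ht
  refine ⟨ht, fun v => ?_⟩
  rw [map_add, map_smul, hx.2, mem_balancedVectors.1 hy v]
  simp

lemma exists_other_fractional {x : E → ℝ} (hx : x ∈ G.fractionalMatchings) {e : E}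
    (he : 0 < x e ∧ x e < 1) {v : V} (hv : G.Incident e (Sum.inl v)) :
    ∃ e', e' ≠ e ∧ (0 < x e' ∧ x e' < 1) ∧ G.Incident e' (Sum.inl v) := by
  classical
  by_contra! hcon
  have h0 : ∀ e', G.Incident e' (Sum.inl v) → e' ≠ e → x e' = 0 := by
    intro e' hv' hne
    by_contra h
    have hlt := add_le_one_of_mem hx hne hv' hv
    exact hcon e' hne ⟨lt_of_le_of_ne (hx.1 e') (Ne.symm h), by linarith⟩ hv'
  have h1 := hx.2 v
  rw [vertexSum_apply, Finset.sum_eq_single e (fun e' he' hne => h0 e' (by simpa using he') hne)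
    (fun h => by simp [hv] at h)] at h1
  linarith [he.2]

/-- The incidence matrix of a bipartite graph is totally unimodular; here this takes the form that a
vertex of the polytope of fractional matchings has coordinates `0` and `1` only. -/
lemma eq_zero_or_one_of_mem_extremePoints [Finite V] {x : E → ℝ}
    (hx : x ∈ G.fractionalMatchings.extremePoints ℝ) (e : E) : x e = 0 ∨ x e = 1 := by
  classical
  have := Fintype.ofFinite V
  by_contra! hcon
  have hxm := hx.1
  have he : 0 < x e ∧ x e < 1 :=
    ⟨lt_of_le_of_ne (hxm.1 e) hcon.1.symm, lt_of_le_of_ne (le_one_of_mem hxm e) hcon.2⟩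
  let S := {e // 0 < x e ∧ x e < 1}
  let T := {v // ∃ e : S, G.Incident e.1 (Sum.inl v)}
  have : Nonempty S := ⟨⟨e, he⟩⟩
  obtain ⟨y, hy0, hy⟩ := exists_ne_zero_balanced (S := S) (T := T)
    (fun e v => G.Incident e.1 (Sum.inl v.1)) (fun v => G.color v.1 = VertexColor.black)
    (by
      rintro ⟨v, e, hv⟩
      obtain ⟨e', hne, he', hv'⟩ := exists_other_fractional hxm e.2 hv
      rw [← Nat.lt_iff_add_one_le, Finset.one_lt_card]
      exact ⟨e, by simpa using hv, ⟨e', he'⟩, by simpa using hv', fun h => hne (by rw [h])⟩)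
    (by
      rintro e ⟨v, hv⟩ ⟨v', hv'⟩ h h' hc
      simp only at h h' hc
      rw [Subtype.mk.injEq]
      rcases h with h | h <;> rcases h' with h' | h'
      · exact Sum.inl_injective (h.symm.trans h')
      · rw [G.color_blackEnd _ _ h, G.color_whiteEnd _ _ h'] at hc
        simp at hc
      · rw [G.color_whiteEnd _ _ h, G.color_blackEnd _ _ h'] at hc
        simp at hc
      · exact Sum.inl_injective (h.symm.trans h'))
  let z : E → ℝ := fun e => if h : 0 < x e ∧ x e < 1 then y ⟨e, h⟩ else 0
  have hzS : ∀ e : S, z e.1 = y e := fun e => dif_pos e.2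
  have hz0 : ∀ e, ¬ (0 < x e ∧ x e < 1) → z e = 0 := fun e h => dif_neg h
  have hzb : z ∈ G.balancedVectors := by
    rw [mem_balancedVectors]
    intro v
    by_cases hv : ∃ e : S, G.Incident e.1 (Sum.inl v)
    · rw [vertexSum_apply, ← hy ⟨v, hv⟩, Finset.sum_filter, Finset.sum_filter]
      simp only [← hzS]
      symm
      refine Finset.sum_of_injOn Subtype.val Subtype.val_injective.injOn (by simp) ?_ ?_
      · intro e _ he
        have h : ¬ (0 < x e ∧ x e < 1) := fun h => he ⟨⟨e, h⟩, by simp, rfl⟩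
        simp [hz0 e h]
      · intro e _
        rfl
    · rw [vertexSum_apply]
      exact Finset.sum_eq_zero fun e he => hz0 e fun h => hv ⟨⟨e, h⟩, by simpa using he⟩
  have hxz : ∀ e, x e = 0 → z e = 0 := fun e h => hz0 e fun h' => h'.1.ne' h
  have h1 := eventually_add_smul_mem hxm hzb hxz
  have h2 := eventually_add_smul_mem hxm (neg_mem hzb) fun e h => by simp [hxz e h]
  obtain ⟨t, ⟨ht1, ht2⟩, ht⟩ := (((h1.and h2).filter_mono nhdsWithin_le_nhds).and
    (self_mem_nhdsWithin (s := Ioi (0 : ℝ)))).exists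
  have ht : 0 < t := ht
  have h3 := hx.2 ht1 ht2 ⟨1 / 2, 1 / 2, by norm_num, by norm_num, by norm_num, by
    ext e
    simp only [Pi.add_apply, Pi.smul_apply, Pi.neg_apply, smul_eq_mul]
    ring⟩
  apply hy0
  ext e
  have h4 := congrFun h3 e.1
  simp only [Pi.add_apply, Pi.smul_apply, smul_eq_mul] at h4
  have h5 : t * z e.1 = 0 := by linarith
  rw [← hzS, Pi.zero_apply]
  exact (mul_eq_zero.1 h5).resolve_left ht.ne'

lemma isAlmostPerfectMatching_of_mem {x : E → ℝ} (hx : x ∈ G.fractionalMatchings)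
    (h : ∀ e, x e = 0 ∨ x e = 1) :
    G.IsAlmostPerfectMatching {e | x e = 1} ∧ x = indicator {e | x e = 1} 1 := by
  classical
  refine ⟨fun v => ?_, ?_⟩
  · have h1 := hx.2 v
    rw [vertexSum_apply] at h1
    obtain ⟨e, he, hne⟩ := Finset.exists_ne_zero_of_sum_ne_zero (by rw [h1]; exact one_ne_zero)
    have he' : G.Incident e (Sum.inl v) := by simpa using he
    have h1e := (h e).resolve_left hne
    refine ⟨e, ⟨h1e, he'⟩, ?_⟩
    rintro e' ⟨h2, h3⟩
    by_contra hne'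
    have h4 := add_le_one_of_mem hx hne' h3 he'
    have h2 : x e' = 1 := h2
    linarith
  · ext e
    rcases h e with h | h <;> simp [indicator, h]

/-- The matching polytope is cut out by nonnegativity and the vertex equations. -/
lemma matchingPolytope_eq [Finite V] (G : PlaneBipartiteGraph n V E) :
    G.matchingPolytope = G.fractionalMatchings := by
  apply Subset.antisymm
  · refine convexHull_min ?_ convex_fractionalMatchings
    rintro _ ⟨M, hM, rfl⟩
    exact hM.indicator_mem
  · rw [← closure_convexHull_extremePoints G.isCompact_fractionalMatchings
      convex_fractionalMatchings]
    have hfin : {x : E → ℝ | ∃ M, G.IsAlmostPerfectMatching M ∧ x = M.indicator 1}.Finite := by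
      refine (finite_range fun M : Set E => (M.indicator 1 : E → ℝ)).subset ?_
      rintro _ ⟨M, -, rfl⟩
      exact ⟨M, rfl⟩
    refine closure_minimal (convexHull_mono fun x hx => ?_) (hfin.isClosed_convexHull ℝ)
    exact ⟨_, isAlmostPerfectMatching_of_mem hx.1 (eq_zero_or_one_of_mem_extremePoints hx)⟩

/-- Around an internal vertex, left sides and right sides are matched up, so that the
contributions of a face cancel. -/
lemma boundaryVector_mem [Finite V] {f : Set ℂ} (hf : G.IsFace f) :
    boundaryVector f G ∈ G.balancedVectors := by
  classical
  rw [mem_balancedVectors]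
  intro v
  obtain ⟨σ, hσ⟩ := G.exists_perm_faces_at v
  rw [vertexSum_apply, Finset.sum_subtype _ (p := fun e => G.Incident e (Sum.inl v)) (by simp)]
  simp only [boundaryVector]
  rw [Finset.sum_sub_distrib, sub_eq_zero,
    ← Equiv.sum_comp σ fun e => indicator {e | G.IsRightFace e f} (1 : E → ℝ) e.1]
  refine Finset.sum_congr rfl fun e _ => ?_
  have h := hσ f hf e
  by_cases h' : G.IsLeftFace e.1 f
  · rw [indicator_of_mem (show e.1 ∈ {e | G.IsLeftFace e f} from h'),
      indicator_of_mem (show (σ e).1 ∈ {e | G.IsRightFace e f} from h.1 h')]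
    rfl
  · rw [indicator_of_notMem (show e.1 ∉ {e | G.IsLeftFace e f} from h'),
      indicator_of_notMem (show (σ e).1 ∉ {e | G.IsRightFace e f} from fun h2 => h' (h.2 h2))]

/-- Summation by parts: a linear functional whose coefficients are the differences of a potential
is a combination of the vertex sums. -/
lemma IsPotential.sum_eq [Fintype V] {h : V ⊕ Fin n → ℝ} {c : E → ℝ} (hc : G.IsPotential h c)
    {y : E → ℝ} (hy : y ∈ G.balancedVectors) : ∑ e, c e * y e = 0 := by
  classical
  let s : V → ℝ := fun v => if G.color v = VertexColor.black then 1 else -1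
  have h0 : ∑ v, s v * h (Sum.inl v) * G.vertexSum v y = 0 :=
    Finset.sum_eq_zero fun v _ => by rw [mem_balancedVectors.1 hy v, mul_zero]
  rw [← h0]
  simp only [vertexSum_apply, Finset.mul_sum, Finset.sum_filter]
  rw [Finset.sum_comm]
  refine Finset.sum_congr rfl fun e _ => ?_
  have hend : ∀ w : V ⊕ Fin n, ∑ v, (if w = Sum.inl v then h (Sum.inl v) else 0) = h w := by
    rintro (v | i)
    · simp
    · simp [hc.1 i]
  have hv : ∀ v, s v * h (Sum.inl v) * (if G.Incident e (Sum.inl v) then y e else 0) =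
      ((if G.blackEnd e = Sum.inl v then h (Sum.inl v) else 0) -
        (if G.whiteEnd e = Sum.inl v then h (Sum.inl v) else 0)) * y e := by
    intro v
    by_cases hb : G.blackEnd e = Sum.inl v
    · have hw : G.whiteEnd e ≠ Sum.inl v := fun hw => G.blackEnd_ne_whiteEnd e (hb.trans hw.symm)
      rw [if_pos (show G.Incident e (Sum.inl v) from Or.inl hb), if_pos hb, if_neg hw]
      simp [s, G.color_blackEnd e v hb]
    · by_cases hw : G.whiteEnd e = Sum.inl v
      · rw [if_pos (show G.Incident e (Sum.inl v) from Or.inr hw), if_neg hb, if_pos hw]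
        simp [s, G.color_whiteEnd e v hw]
      · rw [if_neg (show ¬ G.Incident e (Sum.inl v) from fun h => h.elim hb hw),
          if_neg hb, if_neg hw]
        simp
  simp only [hv]
  rw [← Finset.sum_mul, Finset.sum_sub_distrib, hend, hend, hc.2 e]

/-- The edges with different faces on their two sides are those whose coordinate is not constant on
the matching polytope. -/
lemma equivalent_self_iff [Finite V] {e : E} :
    G.Equivalent e e ↔ ∃ y ∈ G.balancedVectors, y e ≠ 0 := by
  constructor
  · rintro ⟨f, f', h, -⟩
    exact ⟨_, boundaryVector_mem h.2.1.1, by rw [boundaryVector_of_left h]; exact one_ne_zero⟩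
  · rintro ⟨y, hy, hne⟩
    classical
    have := Fintype.ofFinite V
    obtain ⟨f, hf⟩ := G.exists_isLeftFace e
    obtain ⟨f', hf'⟩ := G.exists_isRightFace e
    by_cases hff : f = f'
    · subst hff
      obtain ⟨h, hh⟩ := exists_potential_of_same_face hf hf'
      have h1 := hh.sum_eq hy
      simp [Real.pi_ne_zero, hne] at h1
    · exact ⟨f, f', ⟨hff, hf, hf'⟩, hff, hf, hf'⟩

lemma sub_mem_balancedVectors {x x' : E → ℝ} (hx : x ∈ G.fractionalMatchings)
    (hx' : x' ∈ G.fractionalMatchings) : x - x' ∈ G.balancedVectors := by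
  rw [mem_balancedVectors]
  intro v
  rw [map_sub, hx.2, hx'.2, sub_self]

lemma IsElementary.exists_mem {H : Set E} (hH : G.IsElementary H) {e : E} (he : e ∈ H) :
    ∃ x ∈ G.fractionalMatchings, (∀ a ∉ H, x a = 0) ∧ (∀ a, x a = 0 ∨ x a = 1) ∧ x e = 1 := by
  obtain ⟨M, hMH, hM, heM⟩ := hH e he
  refine ⟨_, hM.indicator_mem, fun a ha => indicator_of_notMem (fun h => ha (hMH h)) _,
    fun a => ?_, by simp [heM]⟩
  by_cases h : a ∈ M <;> simp [h]

lemma mem_faceOfSubgraph [Finite V] {H : Set E} {x : E → ℝ} :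
    x ∈ G.faceOfSubgraph H ↔ x ∈ G.fractionalMatchings ∧ ∀ e ∉ H, x e = 0 := by
  rw [← matchingPolytope_eq]; rfl

/-- A nonempty face `φ(H)` of an elementary subgraph contains a point with support `H`. -/
lemma IsElementary.exists_pos [Finite V] {H : Set E} (hH : G.IsElementary H)
    (h0 : (G.faceOfSubgraph H).Nonempty) :
    ∃ x ∈ G.faceOfSubgraph H, ∀ e ∈ H, 0 < x e := by
  refine exists_pos_of_convex (G.convex_faceOfSubgraph _) h0
    (fun x hx e => (mem_faceOfSubgraph.1 hx).1.1 e) fun e he => ?_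
  obtain ⟨x, hx, h1, -, h2⟩ := hH.exists_mem he
  exact ⟨x, mem_faceOfSubgraph.2 ⟨hx, h1⟩, by rw [h2]; exact one_ne_zero⟩

lemma IsElementary.faceOfSubgraph_nonempty [Finite V] {H : Set E} (hH : G.IsElementary H)
    (h : H.Nonempty) : (G.faceOfSubgraph H).Nonempty := by
  obtain ⟨e, he⟩ := h
  obtain ⟨x, hx, h1, -⟩ := hH.exists_mem he
  exact ⟨x, mem_faceOfSubgraph.2 ⟨hx, h1⟩⟩

/-- The balanced vectors supported on `H` are the directions of the face `φ(H)`. -/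
lemma vectorSpan_faceOfSubgraph [Finite V] {H : Set E} (hH : G.IsElementary H)
    (h0 : (G.faceOfSubgraph H).Nonempty) {W : Submodule ℝ (E → ℝ)}
    (hW : ∀ y, y ∈ W ↔ y ∈ G.balancedVectors ∧ ∀ e ∉ H, y e = 0) :
    vectorSpan ℝ (G.faceOfSubgraph H) = W := by
  obtain ⟨x, hx, hpos⟩ := hH.exists_pos h0
  have hx' := mem_faceOfSubgraph.1 hx
  refine vectorSpan_eq_of_forall hx (fun y hy => ?_) fun w hw => ?_
  · have hy' := mem_faceOfSubgraph.1 hy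
    refine (hW _).2 ⟨sub_mem_balancedVectors hy'.1 hx'.1, fun e he => ?_⟩
    simp [hx'.2 e he, hy'.2 e he]
  · obtain ⟨hw1, hw2⟩ := (hW w).1 hw
    have h := eventually_add_smul_mem hx'.1 hw1 fun e he => hw2 e fun heH => (hpos e heH).ne' he
    obtain ⟨t, h1, h2⟩ := ((h.filter_mono nhdsWithin_le_nhds).and
      (self_mem_nhdsWithin (s := Ioi (0 : ℝ)))).exists
    refine ⟨t, (show (0 : ℝ) < t from h2).ne', mem_faceOfSubgraph.2 ⟨h1, fun e he => ?_⟩⟩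
    simp [hx'.2 e he, hw2 e he]

lemma vectorSpan_matchingPolytope [Finite V] (hG : G.IsElementary univ)
    (h0 : G.matchingPolytope.Nonempty) :
    vectorSpan ℝ G.matchingPolytope = G.balancedVectors := by
  rw [← faceOfSubgraph_univ] at h0 ⊢
  exact vectorSpan_faceOfSubgraph hG h0 fun y => by simp

/-- Coordinates that agree on the matching polytope agree on all its directions. -/
lemma eq_on_balancedVectors [Finite V] (hG : G.IsElementary univ) {e e' : E}
    (h : ∀ x ∈ G.matchingPolytope, x e = x e') {y : E → ℝ} (hy : y ∈ G.balancedVectors) :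
    y e = y e' := by
  have h0 : G.matchingPolytope.Nonempty := by
    rw [← faceOfSubgraph_univ]
    exact hG.faceOfSubgraph_nonempty ⟨e, mem_univ e⟩
  have hle : vectorSpan ℝ G.matchingPolytope ≤
      LinearMap.ker (LinearMap.proj (R := ℝ) (φ := fun _ : E => ℝ) e - LinearMap.proj e') := by
    rw [vectorSpan_def, Submodule.span_le]
    rintro _ ⟨a, ha, b, hb, rfl⟩
    simp [h a ha, h b hb]
  rw [vectorSpan_matchingPolytope hG h0] at hle
  have := hle hy
  rwa [LinearMap.mem_ker, LinearMap.sub_apply, LinearMap.proj_apply, LinearMap.proj_apply,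
    sub_eq_zero] at this

/-- For equivalent edges the difference of the coordinates is constant because of the potential
given by a closed curve that crosses only these two edges. Conversely, coordinates that agree on
the polytope agree on the boundary vectors of the faces, which determine the faces on both sides
of an edge. -/
lemma equivalent_iff [Finite V] (hG : G.IsElementary univ) {e e' : E} (he : G.Equivalent e e) :
    G.Equivalent e e' ↔ ∀ x ∈ G.matchingPolytope, x e = x e' := by
  classical
  constructor
  · intro hee x hx
    by_cases hne : e = e'
    · rw [hne]
    have := Fintype.ofFinite V
    obtain ⟨h, hh⟩ := exists_potential_of_equivalent hee hne
    have key : ∀ y ∈ G.balancedVectors, y e = y e' := by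
      intro y hy
      have h1 := hh.sum_eq hy
      have h2 : ∀ a, (if a = e then 2 * Real.pi else if a = e' then -(2 * Real.pi) else 0) * y a =
          (if a = e then 2 * Real.pi * y a else 0) - (if a = e' then 2 * Real.pi * y a else 0) := by
        intro a
        by_cases h1 : a = e
        · have h2 : a ≠ e' := h1 ▸ hne
          simp [h1, hne]
        · by_cases h2 : a = e' <;> simp [h1, h2]
          simp [Ne.symm hne]
      simp only [h2] at h1
      rw [Finset.sum_sub_distrib] at h1
      simp only [Finset.sum_ite_eq', Finset.mem_univ, if_true] at h1
      rw [← mul_sub] at h1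
      exact sub_eq_zero.1 ((mul_eq_zero.1 h1).resolve_left (by positivity))
    -- the constant value of `x e - x e'` is `≥ 0` by a matching through `e` and `≤ 0` by one
    -- through `e'`
    rw [matchingPolytope_eq] at hx
    obtain ⟨x₁, hx₁, -, -, h1⟩ := hG.exists_mem (mem_univ e)
    obtain ⟨x₂, hx₂, -, -, h2⟩ := hG.exists_mem (mem_univ e')
    have k1 := key _ (sub_mem_balancedVectors hx hx₁)
    have k2 := key _ (sub_mem_balancedVectors hx hx₂)
    simp only [Pi.sub_apply] at k1 k2
    have l1 := le_one_of_mem hx₁ e'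
    have l2 := le_one_of_mem hx₂ e
    linarith
  · intro h
    obtain ⟨f, f', hs, -⟩ := he
    refine ⟨f, f', hs, hs.1, isLeftFace_of_boundaryVector ?_, isRightFace_of_boundaryVector ?_⟩
    · rw [← eq_on_balancedVectors hG h (boundaryVector_mem hs.2.1.1), boundaryVector_of_left hs]
    · rw [← eq_on_balancedVectors hG h (boundaryVector_mem hs.2.2.1), boundaryVector_of_right hs]

end PlaneBipartiteGraph

/-! ### Faces and facets of the matching polytope -/

lemma finrank_inf_ker_add_one {M : Type*} [AddCommGroup M] [Module ℝ M] [FiniteDimensional ℝ M]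
    {K : Submodule ℝ M} {φ : M →ₗ[ℝ] ℝ} (h : ∃ y ∈ K, φ y ≠ 0) :
    Module.finrank ℝ (K ⊓ LinearMap.ker φ : Submodule ℝ M) + 1 = Module.finrank ℝ K := by
  obtain ⟨y, hy, hne⟩ := h
  have h1 : φ ∘ₗ K.subtype ≠ 0 := fun h => hne (LinearMap.congr_fun h ⟨y, hy⟩)
  rw [← Module.Dual.finrank_ker_add_one_of_ne_zero (f := φ ∘ₗ K.subtype) h1,
    ← Submodule.map_comap_subtype, Submodule.finrank_map_subtype_eq]
  rfl

namespace PlaneBipartiteGraph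

variable {n : ℕ} {V E : Type*} {G : PlaneBipartiteGraph n V E}

/-- A point of the matching polytope is a mixture of matchings contained in its support. -/
lemma exists_matching_of_ne_zero {x : E → ℝ} (hx : x ∈ G.matchingPolytope) {e : E}
    (he : x e ≠ 0) : ∃ M, G.IsAlmostPerfectMatching M ∧ e ∈ M ∧ ∀ a ∈ M, x a ≠ 0 := by
  obtain ⟨ι, _, w, z, hw0, -, hz, hsum⟩ := mem_convexHull_iff_exists_fintype.1 hx
  have hx' : ∀ a, x a = ∑ i, w i * z i a := fun a => by
    rw [← hsum, Finset.sum_apply]; rfl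
  rw [hx'] at he
  obtain ⟨i, -, hi⟩ := Finset.exists_ne_zero_of_sum_ne_zero he
  have hnn : ∀ a j, 0 ≤ w j * z j a := by
    intro a j
    obtain ⟨M, -, hM⟩ := hz j
    rw [hM]
    exact mul_nonneg (hw0 j) (indicator_nonneg (fun _ _ => zero_le_one) a)
  obtain ⟨M, hM, hzM⟩ := hz i
  refine ⟨M, hM, ?_, fun a ha h0 => ?_⟩
  · by_contra h
    apply hi
    rw [hzM, indicator_of_notMem h, mul_zero]
  · rw [hx', Finset.sum_eq_zero_iff_of_nonneg fun j _ => hnn a j] at h0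
    have h1 := h0 i (Finset.mem_univ i)
    rw [hzM, indicator_of_mem ha, Pi.one_apply, mul_one] at h1
    exact hi (by rw [h1, zero_mul])

lemma supportingEdges_faceOfSubgraph [Finite V] [Finite E] {H : Set E} (hH : G.IsElementary H) :
    supportingEdges (G.faceOfSubgraph H) = H := by
  have := Fintype.ofFinite E
  ext e
  constructor
  · rintro ⟨x, hx, hne⟩
    by_contra he
    exact hne (hx.2 e he)
  · intro he
    obtain ⟨x, hx, h1, -, h2⟩ := hH.exists_mem he
    exact ⟨x, mem_faceOfSubgraph.2 ⟨hx, h1⟩, by rw [h2]; exact one_ne_zero⟩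

lemma isElementary_supportingEdges {F : Set (E → ℝ)} (hF : F ⊆ G.matchingPolytope) :
    G.IsElementary (supportingEdges F) := by
  rintro e ⟨x, hx, hne⟩
  obtain ⟨M, hM, heM, hs⟩ := exists_matching_of_ne_zero (hF hx) hne
  exact ⟨M, fun a ha => ⟨x, hx, hs a ha⟩, hM, heM⟩

lemma IsEdgeClass.exists_eq {C : Set E} (hC : G.IsEdgeClass C) :
    ∃ e, G.Equivalent e e ∧ C = {e' | G.Equivalent e e'} := by
  obtain ⟨e, he, hC'⟩ := hC
  refine ⟨e, ?_, hC'⟩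
  rw [hC'] at he
  exact he

variable [Finite V] [Fintype E]

/-- A nonempty exposed face of the matching polytope is determined by its supporting edges: a point
of the face that is positive on all of them can be moved a little away from any point of the
polytope supported on these edges. -/
lemma faceOfSubgraph_supportingEdges {F : Set (E → ℝ)} (h0 : F.Nonempty)
    (hF : IsExposed ℝ G.matchingPolytope F) : G.faceOfSubgraph (supportingEdges F) = F := by
  have hsub := hF.subset
  obtain ⟨x₁, hx₁, hpos⟩ := exists_pos_of_convex (hF.convex (convex_convexHull ℝ _)) h0
    (fun x hx e => ((matchingPolytope_eq G).subset (hsub hx)).1 e) (H := supportingEdges F)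
    fun e he => he
  apply Subset.antisymm
  · intro x hx
    obtain ⟨l, hl⟩ := hF h0
    have hx' := mem_faceOfSubgraph.1 hx
    have hx₁' := (matchingPolytope_eq G).subset (hsub hx₁)
    have h1 := eventually_add_smul_mem hx₁' (sub_mem_balancedVectors hx₁' hx'.1) fun e he => by
      have h2 : e ∉ supportingEdges F := fun h => (hpos e h).ne' he
      simp [he, hx'.2 e h2]
    obtain ⟨t, h2, h3⟩ := ((h1.filter_mono nhdsWithin_le_nhds).and
      (self_mem_nhdsWithin (s := Ioi (0 : ℝ)))).exists
    have h3 : 0 < t := h3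
    rw [hl] at hx₁ ⊢
    rw [← matchingPolytope_eq] at h2
    have h4 := hx₁.2 _ h2
    rw [map_add, map_smul, map_sub, smul_eq_mul] at h4
    refine ⟨hx.1, fun y hy => (hx₁.2 y hy).trans ?_⟩
    nlinarith
  · intro x hx
    refine ⟨hsub hx, fun e he => ?_⟩
    by_contra h
    exact he ⟨x, hx, h⟩

/-- A coordinate that is not constant on the matching polytope cuts the directions of the polytope
down by one dimension. -/
lemma finrank_balancedVectors {e : E} (he : G.Equivalent e e) :
    Module.finrank ℝ (G.balancedVectors ⊓
      LinearMap.ker (LinearMap.proj (R := ℝ) (φ := fun _ : E => ℝ) e) : Submodule ℝ (E → ℝ)) + 1 =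
      Module.finrank ℝ G.balancedVectors :=
  finrank_inf_ker_add_one (equivalent_self_iff.1 he)

/-- Not all edges are equivalent: otherwise the vertex equations would determine their common
coordinate. -/
lemma exists_not_equivalent (hG : G.IsElementary univ) {e : E} (he : G.Equivalent e e) :
    ∃ e', ¬ G.Equivalent e e' := by
  classical
  by_contra! hcon
  obtain ⟨y, hy, hne⟩ := equivalent_self_iff.1 he
  obtain ⟨v, hv⟩ := G.exists_incident e
  have h1 := mem_balancedVectors.1 hy v
  rw [vertexSum_apply, Finset.sum_congr rfl fun e' _ =>
    (eq_on_balancedVectors hG ((equivalent_iff hG he).1 (hcon e')) hy).symm, Finset.sum_const,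
    nsmul_eq_mul, mul_eq_zero] at h1
  rcases h1 with h1 | h1
  · rw [Nat.cast_eq_zero, Finset.card_eq_zero] at h1
    have : e ∈ (Finset.univ.filter fun e => G.Incident e (Sum.inl v)) := by simpa using hv
    rw [h1] at this
    simp at this
  · exact hne h1

lemma isPolytopeFacet_faceOfSubgraph (hG : G.IsElementary univ) {e : E} (he : G.Equivalent e e)
    (hH : G.IsElementary (univ \ {e' | G.Equivalent e e'})) :
    IsPolytopeFacet G.matchingPolytope (G.faceOfSubgraph (univ \ {e' | G.Equivalent e e'})) := by
  have hne : (G.faceOfSubgraph (univ \ {e' | G.Equivalent e e'})).Nonempty := by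
    obtain ⟨e', he'⟩ := exists_not_equivalent hG he
    exact hH.faceOfSubgraph_nonempty ⟨e', mem_univ _, he'⟩
  have hmem : ∀ x ∈ G.matchingPolytope,
      (x ∈ G.faceOfSubgraph (univ \ {e' | G.Equivalent e e'}) ↔ x e = 0) := by
    intro x hx
    constructor
    · intro h
      exact h.2 e fun h' => h'.2 he
    · intro h
      refine ⟨hx, fun e' he' => ?_⟩
      have : G.Equivalent e e' := by simpa using he'
      rw [← (equivalent_iff hG he).1 this x hx, h]
  refine ⟨hne, fun _ => ⟨-ContinuousLinearMap.proj e, ?_⟩, ?_⟩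
  · obtain ⟨x₀, hx₀⟩ := hne
    ext x
    constructor
    · intro hx
      refine ⟨hx.1, fun y hy => ?_⟩
      have h1 := ((matchingPolytope_eq G).subset hy).1 e
      have h2 := (hmem x hx.1).1 hx
      simpa [h2] using h1
    · rintro ⟨hx, h⟩
      refine (hmem x hx).2 (le_antisymm ?_ (((matchingPolytope_eq G).subset hx).1 e))
      have h1 := h x₀ hx₀.1
      simpa [(hmem x₀ hx₀.1).1 hx₀] using h1
  · rw [vectorSpan_matchingPolytope hG (hne.mono fun x hx => hx.1),
      ← finrank_balancedVectors he, vectorSpan_faceOfSubgraph hH hne fun y => ?_]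
    rw [Submodule.mem_inf, LinearMap.mem_ker, LinearMap.proj_apply]
    refine and_congr_right fun hy => ⟨fun h e' he' => ?_, fun h => h e fun h' => h'.2 he⟩
    have : G.Equivalent e e' := by simpa using he'
    rw [← eq_on_balancedVectors hG ((equivalent_iff hG he).1 this) hy, h]

/-- A facet is the locus where the coordinates of an edge class vanish. Each coordinate vanishing on
the facet is proportional to a fixed one, and the factor is `1` since matchings have coordinates
`0` and `1`. -/
lemma exists_supportingEdges_eq (hG : G.IsElementary univ) {F : Set (E → ℝ)}
    (hF : IsPolytopeFacet G.matchingPolytope F) :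
    ∃ C, G.IsEdgeClass C ∧ supportingEdges F = univ \ C := by
  obtain ⟨h0, hexp, hdim⟩ := hF
  have hface := faceOfSubgraph_supportingEdges h0 hexp
  have hel := isElementary_supportingEdges hexp.subset
  set H := supportingEdges F
  have hH : H ≠ univ := by
    intro h
    rw [h, faceOfSubgraph_univ] at hface
    rw [hface] at hdim
    omega
  obtain ⟨e₀, he₀⟩ := (ne_univ_iff_exists_notMem H).1 hH
  obtain ⟨x₁, hx₁⟩ := h0
  rw [← hface] at hx₁ hdim
  have hx₁' := mem_faceOfSubgraph.1 hx₁
  obtain ⟨x₂, hx₂, -, h01, h2⟩ := hG.exists_mem (mem_univ e₀)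
  have hy₀ := sub_mem_balancedVectors hx₂ hx₁'.1
  have hy₀e : (x₂ - x₁) e₀ = 1 := by simp [h2, hx₁'.2 e₀ he₀]
  have hself : G.Equivalent e₀ e₀ :=
    equivalent_self_iff.2 ⟨_, hy₀, by rw [hy₀e]; exact one_ne_zero⟩
  refine ⟨_, ⟨e₀, hself, rfl⟩, ?_⟩
  let W : Submodule ℝ (E → ℝ) := G.balancedVectors ⊓
    ⨅ e, ⨅ (_ : e ∉ H), LinearMap.ker (LinearMap.proj (R := ℝ) (φ := fun _ : E => ℝ) e)
  have hW : ∀ y, y ∈ W ↔ y ∈ G.balancedVectors ∧ ∀ e ∉ H, y e = 0 := fun y => by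
    simp [W]
  rw [vectorSpan_faceOfSubgraph hel ⟨x₁, hx₁⟩ hW,
    vectorSpan_matchingPolytope hG ⟨x₁, hx₁.1⟩, ← finrank_balancedVectors hself] at hdim
  have hWeq := Submodule.eq_of_le_of_finrank_eq (fun y hy => by
    obtain ⟨h1, h2⟩ := (hW y).1 hy
    exact ⟨h1, h2 e₀ he₀⟩) (Nat.add_right_cancel hdim)
  ext e
  simp only [Set.mem_sdiff, mem_univ, true_and]
  change e ∈ H ↔ ¬ G.Equivalent e₀ e
  rw [← not_iff_not, not_not, equivalent_iff hG hself]
  constructor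
  · intro he
    have key : ∀ y ∈ G.balancedVectors, y e = y e₀ * x₂ e := by
      intro y hy
      have hmem : y - y e₀ • (x₂ - x₁) ∈ W := by
        rw [hWeq]
        refine ⟨sub_mem hy (Submodule.smul_mem _ _ hy₀), ?_⟩
        rw [SetLike.mem_coe, LinearMap.mem_ker, LinearMap.proj_apply, Pi.sub_apply, Pi.smul_apply,
          hy₀e, smul_eq_mul, mul_one, sub_self]
      have h3 := ((hW _).1 hmem).2 e he
      simp only [Pi.sub_apply, Pi.smul_apply, smul_eq_mul, hx₁'.2 e he, sub_zero] at h3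
      linarith
    have hP : ∀ x ∈ G.fractionalMatchings, x e = x e₀ * x₂ e := by
      intro x hx
      have h3 := key _ (sub_mem_balancedVectors hx hx₁'.1)
      simpa [hx₁'.2 e he, hx₁'.2 e₀ he₀] using h3
    intro x hx
    rcases h01 e with h3 | h3
    · obtain ⟨x₃, hx₃, -, -, h4⟩ := hG.exists_mem (mem_univ e)
      have h5 := hP x₃ hx₃
      rw [h3, h4, mul_zero] at h5
      exact absurd h5 one_ne_zero
    · rw [hP x ((matchingPolytope_eq G).subset hx), h3, mul_one]
  · rintro h ⟨x, hx, hne⟩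
    rw [← hface] at hx
    exact hne (by rw [← h x hx.1, hx.2 e₀ he₀])

end PlaneBipartiteGraph

theorem mainTheorem6 {n : ℕ} {V E : Type*} [Finite V] [Finite E]
    (G : PlaneBipartiteGraph n V E) (hG : G.IsElementary Set.univ) :
    (Set.BijOn G.faceOfSubgraph
        {H | G.IsElementary H ∧ ∃ C, G.IsEdgeClass C ∧ H = Set.univ \ C}
        {F | IsPolytopeFacet G.matchingPolytope F} ∧
      Set.InvOn supportingEdges G.faceOfSubgraph
        {H | G.IsElementary H ∧ ∃ C, G.IsEdgeClass C ∧ H = Set.univ \ C}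
        {F | IsPolytopeFacet G.matchingPolytope F}) ∧
    (∀ e e' : E, G.Equivalent e e →
      (G.Equivalent e e' ↔ ∀ x ∈ G.matchingPolytope, x e = x e')) := by
  have := Fintype.ofFinite E
  have hinv : Set.InvOn supportingEdges G.faceOfSubgraph
      {H | G.IsElementary H ∧ ∃ C, G.IsEdgeClass C ∧ H = Set.univ \ C}
      {F | IsPolytopeFacet G.matchingPolytope F} :=
    ⟨fun H hH => PlaneBipartiteGraph.supportingEdges_faceOfSubgraph hH.1,
      fun F hF => PlaneBipartiteGraph.faceOfSubgraph_supportingEdges hF.1 hF.2.1⟩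
  refine ⟨⟨hinv.bijOn ?_ ?_, hinv⟩, fun e e' he => PlaneBipartiteGraph.equivalent_iff hG he⟩
  · rintro H ⟨hH, C, hC, rfl⟩
    obtain ⟨e, he, rfl⟩ := hC.exists_eq
    exact PlaneBipartiteGraph.isPolytopeFacet_faceOfSubgraph hG he hH
  · intro F hF
    exact ⟨PlaneBipartiteGraph.isElementary_supportingEdges hF.2.1.subset,
      PlaneBipartiteGraph.exists_supportingEdges_eq hG hF⟩
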